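/- Let $\mathrm{Nil}_3=\mathbb R^3$ with product $(x_1,x_2,x_3)\cdot(y_1,y_2,y_3)=(x_1+y_1,\,x_2+y_2,\,x_3+y_3+\tfrac12(x_1y_2-y_1x_2))$, left-invariant metric $dx_1^2+dx_2^2+(dx_3+\tfrac12(x_2dx_1-x_1dx_2))^2$, and left-invariant orthonormal frame $e_1,e_2,e_3$ (equal to the coordinate frame at the identity), which fixes the orientation and identifies the Lie algebra with $\mathbb R^3$. For a smooth map $f$ from a domain of $\mathbb C$ (coordinate $z$) to $\mathrm{Nil}_3$ write $f^{-1}f_z=\sum_k\phi_ke_k$. It is a conformal immersion if $\sum_k\phi_k^2=0$ and $e^u:=2\sum_k|\phi_k|^2\neq0$; the metric is then $e^u|dz|^2$. For a unit normal $N$ let $H$ be the mean curvature with respect to $N$, $h=\langle e^{u/2}f^{-1}N,e_3\rangle$ the support, $\mathcal U=-\tfrac H2e^{u/2}+\tfrac i4h$ the Dirac potential, and $g\in\mathbb C\cup\{\infty\}$ the stereographic projection of $f^{-1}N$ from the south pole. The surface is minimal if $H\equiv 0$, and nowhere-vertical if $\langle f^{-1}N,e_3\rangle$ has no zeros. Functions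 $\psi_1,\psi_2$ are *generating spinors* of $(f,N)$ if they are smooth and $$(\phi_1,\phi_2,\phi_3)=\sigma\,\bigl(\overline{\psi_2}^2-\psi_1^2,\; i(\overline{\psi_2}^2+\psi_1^2),\; 2\psi_1\overline{\psi_2}\bigr),$$ where $\sigma=1$ if $N$ is the positively oriented normal ($(f_x,f_y,N)$ positive) and $\sigma=-1$ if $N$ is the opposite one. The Abresch–Rosenberg differential is $4B\,dz^2$, where, with $N$ and $H$ taken for the positively oriented normal and $f_{zz}=\nabla_{\partial_z}f_z$ ($\nabla$ the Levi-Civita connection), $$B=\tfrac{2H+i}{4}\Bigl(\langle f_{zz},N\rangle+\tfrac{\phi_3^2}{2H+i}\Bigr).$$ **Theorem.** Let $D\subset\mathbb C$ be open and simply connected, and let $f:D\to\mathrm{Nil}_3$ be a nowhere-vertical conformal minimal immersion with positively oriented unit normal $N$, generating spinors $\psi_1,\psi_2$, and $B\not\equiv0$. Let $e^u,h,g$ be the conformal factor, support and normal Gauss map of $(f,N)$. Then the zeros of $B$ are isolated; put $D'=\{z\in D: B(z)\ne0\}$. On every open $V\subset D'$ with a continuous branch of $\sqrt{-B}$, choose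 the branch $\sqrt{-\overline B}:=-\overline{\sqrt{-B}}$ and define the dual spinors $$\psi_1^*=\frac{4\sqrt{-B}}{h}\psi_2,\qquad \psi_2^*=\frac{4\sqrt{-\overline B}}{h}\psi_1 .$$ They are smooth, and there is a smooth $w^*$ on $V$ with $e^{w^*/2}=4i|B|/h$ such that, with $B^*=B$, the row vector $\tilde\psi^*=(\psi_1^*,\psi_2^*)$ satisfies $$\tilde\psi^*_z=\tilde\psi^*\begin{pmatrix}\frac12w^*_z&-e^{w^*/2}\\ B^*e^{-w^*/2}&0\end{pmatrix},\qquad \tilde\psi^*_{\bar z}=\tilde\psi^*\begin{pmatrix}0&-\overline{B^*}e^{-w^*/2}\\ e^{w^*/2}&\frac12w^*_{\bar z}\end{pmatrix}.$$ Moreover there is a *dual surface* of $(f,N)$ on $D$: a smooth map $f^*:D\to\mathrm{Nil}_3$ such that, on every such $V$ and for every choice of the branch and of generating spinors $\psi_1,\psi_2$ of $(f,N)$ on $V$, $\psi_1^*,\psi_2^*$ are generating spinors of $(f^*,N^*)$, where $N^*$ is a unit normal of $f^*$ with $(f^*)^{-1}N^*=f^{-1}N$. Every dual surface $f^*$ has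 the following properties. 1. On $D'$ it is a conformal immersion whose left-translated positively oriented unit normal is $-f^{-1}N$. With the opposite choice $(f^*)^{-1}N^*=f^{-1}N$, the Dirac potential of $f^*$ is $4i|B|/h$, and the conformal factor, support, Abresch–Rosenberg differential and normal Gauss map of $f^*$ are given by $$e^{u^*}=\frac{4^4|B|^2}{h^4}e^u,\qquad h^*=\frac{4^2|B|}{h},\qquad B^*=B,\qquad g^*=g .$$ The first formula holds on all of $D$, so $f^*$ fails to be immersed exactly at the zeros of $B$. 2. On $D'$, $f^*$ is nowhere-vertical and minimal. 3. $f^{**}=f$ on $D'$ up to a rigid motion: $f|_{D'}$ is a dual surface of $(f^*|_{D'},N^*)$ (defined in the same way, with the spinors, support and $B^*$ of $(f^*,N^*)$ in place of those of $(f,N)$), and every dual surface $f^{**}$ of $(f^*|_{D'},N^*)$ has the form $f^{**}=p\cdot f$ on $D'$ for some $p\in\mathrm{Nil}_3$. -/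

import Mathlib

open scoped Matrix ContDiff Topology ComplexConjugate

noncomputable section

/-- Points of the Heisenberg group, and vectors of its Lie algebra written in the basis
`e₁, e₂, e₃` (indices `0, 1, 2`). -/
abbrev R3 : Type := Fin 3 → ℝ

/-! ### The Heisenberg group `Nil₃` and its left-invariant metric -/

/-- The multiplication of `Nil₃`. -/
def nilMul (p q : R3) : R3 :=
  ![p 0 + q 0, p 1 + q 1, p 2 + q 2 + (1 / 2) * (p 0 * q 1 - q 0 * p 1)]

theorem nilMul_assoc (p q r : R3) : nilMul (nilMul p q) r = nilMul p (nilMul q r) := by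
  ext i; fin_cases i <;> simp [nilMul] <;> ring

theorem nilMul_zero (p : R3) : nilMul p 0 = p := by
  ext i; fin_cases i <;> simp [nilMul]

theorem zero_nilMul (p : R3) : nilMul 0 p = p := by
  ext i; fin_cases i <;> simp [nilMul]

/-- The inverse of `p` in `Nil₃` is `-p`. -/
theorem neg_nilMul (p : R3) : nilMul (-p) p = 0 := by
  ext i; fin_cases i <;> simp [nilMul, mul_comm]

/-- The Maurer--Cartan form of `Nil₃`: a tangent vector `v` at `p` (in the coordinates
`x₁, x₂, x₃`) is translated to the Lie algebra by left translation. Its components are the values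
at `v` of the coframe `dx₁, dx₂, dx₃ + (x₂ dx₁ - x₁ dx₂)/2`. -/
def leftTriv (p v : R3) : R3 :=
  ![v 0, v 1, v 2 + (1 / 2) * (p 1 * v 0 - p 0 * v 1)]

/-- `leftTriv p` is the differential at `p` of the left translation by `p⁻¹`. -/
theorem hasDerivAt_leftTriv (p v : R3) :
    HasDerivAt (fun t : ℝ => nilMul (-p) (p + t • v)) (leftTriv p v) 0 := by
  rw [hasDerivAt_pi]
  intro i
  have h : ∀ c d : ℝ, HasDerivAt (fun t : ℝ => c + t * d) d 0 := fun c d => by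
    simpa using ((hasDerivAt_id (0 : ℝ)).mul_const d).const_add c
  fin_cases i
  · exact (h 0 (v 0)).congr_of_eventuallyEq (.of_forall fun t => by simp [nilMul])
  · exact (h 0 (v 1)).congr_of_eventuallyEq (.of_forall fun t => by simp [nilMul])
  · exact (h 0 (v 2 + (1 / 2) * (p 1 * v 0 - p 0 * v 1))).congr_of_eventuallyEq
      (.of_forall fun t => by simp [nilMul]; ring)

/-- The left-invariant metric `dx₁² + dx₂² + (dx₃ + (x₂ dx₁ - x₁ dx₂)/2)²` at `p`. -/
def nilMetric (p v v' : R3) : ℝ := leftTriv p v ⬝ᵥ leftTriv p v'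

theorem nilMetric_eq (p v v' : R3) :
    nilMetric p v v' = v 0 * v' 0 + v 1 * v' 1 +
      (v 2 + (1 / 2) * (p 1 * v 0 - p 0 * v 1)) * (v' 2 + (1 / 2) * (p 1 * v' 0 - p 0 * v' 1)) := by
  simp [nilMetric, leftTriv, dotProduct, Fin.sum_univ_three]

/-- The Lie bracket of `nil₃`: `[e₁, e₂] = e₃`, and `e₃` is central. -/
def nilBracket {K : Type*} [Field K] (a b : Fin 3 → K) : Fin 3 → K :=
  ![0, 0, a 0 * b 1 - a 1 * b 0]

/-- The Levi-Civita connection of the left-invariant metric: for left-invariant vector fields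
`a, b` this is `∇_a b`. -/
def nilConn {K : Type*} [Field K] (a b : Fin 3 → K) : Fin 3 → K :=
  ![(a 1 * b 2 + a 2 * b 1) / 2, -(a 0 * b 2 + a 2 * b 0) / 2, (a 0 * b 1 - a 1 * b 0) / 2]

/-- `nilConn` is torsion-free. -/
theorem nilConn_sub_nilConn (a b : R3) : nilConn a b - nilConn b a = nilBracket a b := by
  ext i; fin_cases i <;> simp [nilConn, nilBracket] <;> ring

/-- `nilConn` is metric. -/
theorem nilConn_dotProduct_add (a b c : R3) : nilConn a b ⬝ᵥ c + b ⬝ᵥ nilConn a c = 0 := by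
  simp [nilConn, dotProduct, Fin.sum_univ_three]; ring

/-! ### Surfaces in `Nil₃`

A surface is a map `f` on a domain of `ℂ`, with coordinate `z = x + i y`. -/

/-- The Wirtinger derivative `∂/∂z`. -/
def dz (F : ℂ → ℂ) (z : ℂ) : ℂ :=
  (1 / 2) * (fderiv ℝ F z 1 - Complex.I * fderiv ℝ F z Complex.I)

/-- The Wirtinger derivative `∂/∂z̄`. -/
def dzbar (F : ℂ → ℂ) (z : ℂ) : ℂ :=
  (1 / 2) * (fderiv ℝ F z 1 + Complex.I * fderiv ℝ F z Complex.I)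

/-- `f⁻¹ df (v)`; for `v = 1` this is `f⁻¹ f_x` and for `v = i` it is `f⁻¹ f_y`. -/
def leftVel (f : ℂ → R3) (v : ℂ) (z : ℂ) : R3 := leftTriv (f z) (fderiv ℝ f z v)

/-- `f⁻¹ f_z = (φ₁, φ₂, φ₃)`. -/
def phi (f : ℂ → R3) (z : ℂ) : Fin 3 → ℂ :=
  fun k => (1 / 2) * ((leftVel f 1 z k : ℂ) - Complex.I * (leftVel f Complex.I z k : ℂ))

/-- The conformal factor `e^u`, determined by `∑ₖ |φₖ|² = e^u / 2`. -/
def confFactor (f : ℂ → R3) (z : ℂ) : ℝ := 2 * ∑ k, ‖phi f z k‖ ^ 2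

/-- `f` is a smooth conformal immersion on the open set `D`. -/
def IsConformalImmersion (D : Set ℂ) (f : ℂ → R3) : Prop :=
  ContDiffOn ℝ ∞ f D ∧ ∀ z ∈ D, ∑ k, phi f z k ^ 2 = 0 ∧ confFactor f z ≠ 0

/-- The left-translated positively oriented unit normal `f⁻¹ N`. -/
def unitNormal (f : ℂ → R3) (z : ℂ) : R3 :=
  let n : R3 := leftVel f 1 z ⨯₃ leftVel f Complex.I z
  (Real.sqrt (n ⬝ᵥ n))⁻¹ • n

/-- `N` is a left-translated unit normal field of `f` on `D`, of either orientation. -/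
def IsUnitNormal (D : Set ℂ) (f N : ℂ → R3) : Prop :=
  ∀ z ∈ D, N z ⬝ᵥ N z = 1 ∧ N z ⬝ᵥ leftVel f 1 z = 0 ∧ N z ⬝ᵥ leftVel f Complex.I z = 0

/-- The covariant derivative, in the direction `v`, of the vector field along `f` whose
left translation is `W`. -/
def covDeriv (f : ℂ → R3) (v : ℂ) (W : ℂ → R3) (z : ℂ) : R3 :=
  fderiv ℝ W z v + nilConn (leftVel f v z) (W z)

/-- The mean curvature, with respect to the unit normal `N`, of a conformal immersion: half the
trace of the second fundamental form. -/
def meanCurv (f N : ℂ → R3) (z : ℂ) : ℝ :=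
  ((covDeriv f 1 (leftVel f 1) z + covDeriv f Complex.I (leftVel f Complex.I) z) ⬝ᵥ N z) /
    (2 * confFactor f z)

/-- A surface is minimal when its mean curvature vanishes. -/
def IsMinimal (D : Set ℂ) (f : ℂ → R3) : Prop := ∀ z ∈ D, meanCurv f (unitNormal f) z = 0

/-- A surface is nowhere-vertical when `e₃` is never tangent to it. -/
def IsNowhereVertical (D : Set ℂ) (f : ℂ → R3) : Prop := ∀ z ∈ D, unitNormal f z 2 ≠ 0

/-- The support `h = ⟨e^{u/2} f⁻¹ N, e₃⟩`. -/
def support (f N : ℂ → R3) (z : ℂ) : ℝ := Real.sqrt (confFactor f z) * N z 2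

/-- The normal Gauss map: stereographic projection of `f⁻¹ N` from the south pole. -/
def gaussMap (N : ℂ → R3) (z : ℂ) : OnePoint ℂ :=
  open Classical in
  if N z 2 = -1 then OnePoint.infty
  else (((N z 0 : ℂ) + Complex.I * (N z 1 : ℂ)) / (1 + (N z 2 : ℂ)) : ℂ)

/-- The left translation of `f_zz = ∇_{∂z} f_z`. -/
def fzz (f : ℂ → R3) (z : ℂ) : Fin 3 → ℂ :=
  (fun k => dz (fun z' => phi f z' k) z) + nilConn (phi f z) (phi f z)

/-- The coefficient `B` of the Abresch--Rosenberg differential `4 B dz²`; `N` and `H` are taken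
with respect to the orientation given by `z`. -/
def abreschRosenberg (f : ℂ → R3) (z : ℂ) : ℂ :=
  let H : ℂ := (meanCurv f (unitNormal f) z : ℂ)
  (2 * H + Complex.I) / 4 *
    (fzz f z ⬝ᵥ (fun k => (unitNormal f z k : ℂ)) + phi f z 2 ^ 2 / (2 * H + Complex.I))

/-- The Dirac potential `-(H/2) e^{u/2} + (i/4) h` with respect to the unit normal `N`. -/
def diracPotential (f N : ℂ → R3) (z : ℂ) : ℂ :=
  -((meanCurv f N z : ℂ) / 2) * (Real.sqrt (confFactor f z) : ℂ) +
    Complex.I / 4 * (support f N z : ℂ)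

/-! ### Spinors -/

/-- The isotropic vector built from a pair of spinors. -/
def spinorVec (a b : ℂ) : Fin 3 → ℂ :=
  ![conj b ^ 2 - a ^ 2, Complex.I * (conj b ^ 2 + a ^ 2), 2 * a * conj b]

/-- The determinant of `(f⁻¹ f_x, f⁻¹ f_y, N)`: positive for a positively oriented normal. -/
def orient (f N : ℂ → R3) (z : ℂ) : ℝ :=
  Matrix.det ![leftVel f 1 z, leftVel f Complex.I z, N z]

/-- `ψ₁, ψ₂` are generating spinors on `D` of the surface `f` with chosen unit normal `N`:
`f⁻¹ f_z` is the isotropic vector of `(ψ₁, ψ₂)` if `N` is positively oriented, and minus this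
vector if `N` is the opposite normal. With this sign the Dirac equations
`∂_z ψ₂ = -𝒰 ψ₁`, `∂_z̄ ψ₁ = 𝒰 ψ₂` hold with `𝒰 = -(H/2) e^{u/2} + (i/4) h` for both normals. -/
def IsGeneratingSpinors (D : Set ℂ) (f N : ℂ → R3) (ψ₁ ψ₂ : ℂ → ℂ) : Prop :=
  ContDiffOn ℝ ∞ ψ₁ D ∧ ContDiffOn ℝ ∞ ψ₂ D ∧ IsUnitNormal D f N ∧
    ∀ z ∈ D, (0 < orient f N z ∧ phi f z = spinorVec (ψ₁ z) (ψ₂ z)) ∨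
      (orient f N z < 0 ∧ phi f z = -spinorVec (ψ₁ z) (ψ₂ z))

/-- The linear spinor system (with constant mean curvature) with Dirac potential `e^{w/2}`. -/
def LinearSpinorSystem (D : Set ℂ) (ψ₁ ψ₂ w B : ℂ → ℂ) : Prop :=
  ∀ z ∈ D,
    ![dz ψ₁ z, dz ψ₂ z] = ![ψ₁ z, ψ₂ z] ᵥ*
      !![(1 / 2) * dz w z, -Complex.exp (w z / 2); B z * Complex.exp (-w z / 2), 0] ∧
    ![dzbar ψ₁ z, dzbar ψ₂ z] = ![ψ₁ z, ψ₂ z] ᵥ*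
      !![0, -conj (B z) * Complex.exp (-w z / 2); Complex.exp (w z / 2), (1 / 2) * dzbar w z]

/-- `s` is a continuous branch of `√(-B)` on `V`, where `B` has no zeros. -/
def IsSqrtBranch (V : Set ℂ) (B s : ℂ → ℂ) : Prop :=
  ContinuousOn s V ∧ ∀ z ∈ V, B z ≠ 0 ∧ s z ^ 2 = -B z

/-- The first dual spinor `4 √(-B) ψ₂ / h`, for the branch `s` of `√(-B)`. -/
def dualSpinor₁ (f N : ℂ → R3) (s ψ₂ : ℂ → ℂ) (z : ℂ) : ℂ :=
  4 * s z / (support f N z : ℂ) * ψ₂ z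

/-- The second dual spinor `4 √(-B̄) ψ₁ / h`, where `√(-B̄)` is the branch `-conj s`. -/
def dualSpinor₂ (f N : ℂ → R3) (s ψ₁ : ℂ → ℂ) (z : ℂ) : ℂ :=
  4 * (-conj (s z)) / (support f N z : ℂ) * ψ₁ z

/-- `fs` is a dual surface on `D` of the surface `f` with unit normal `N`: it is smooth on `D`,
and wherever a branch of `√(-B)` is given, the dual spinors of the generating spinors of `f` are
generating spinors of `fs`, with the same left-translated unit normal `N`. -/
def IsDualSurface (D : Set ℂ) (f N fs : ℂ → R3) : Prop :=
  ContDiffOn ℝ ∞ fs D ∧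
    ∀ V ⊆ D, IsOpen V → ∀ ψ₁ ψ₂ s : ℂ → ℂ,
      IsGeneratingSpinors V f N ψ₁ ψ₂ → IsSqrtBranch V (abreschRosenberg f) s →
        IsGeneratingSpinors V fs N (dualSpinor₁ f N s ψ₂) (dualSpinor₂ f N s ψ₁)

end

/-!
The surface `f` is governed by its Maurer–Cartan form `φ = f⁻¹ f_z`, and the duality takes a simple
form on it: the dual spinors give
`φ* = -(16 B / h²) conj φ` (`dualPhi`, `IsMinimalSpinors.phi_eq_neg_spinorVec_iff`).
This expression contains no square root of `B`, so it is defined on all of `D`, vanishes exactly at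
the zeros of `B`, and is a multiple of `conj φ`, whence the same normal direction with the opposite
orientation.

A minimal conformal immersion is a harmonic map, `∇_{∂z̄} f_z = 0` (`tension_eq_zero`): this vector
is real by the Maurer–Cartan equation, orthogonal to `φ` by conformality and to `N` by minimality.
In terms of the spinors `a, b` this is the Dirac equation `∂a/∂z̄ = (i/4) h b`,
`∂b/∂z = -(i/4) h a` (`IsMinimalSpinors.dirac`). Moreover `B = (i/2) (a ∂b̄ - b̄ ∂a)`
(`IsMinimalSpinors.abreschRosenberg_eq`), which the Dirac equation shows to be holomorphic, so that
its zeros are isolated. Since `h = 2 (|a|² - |b|²)` has no zeros, the remaining derivatives `∂a`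
and `∂b̄` are expressed by `h` and `B`. The linear system for the dual spinors, the harmonic
map equation for `φ*` (`IsMinimalSpinors.dzbar_dualPhi`) and the formula `B* = B` are then
algebra.

The harmonic map equation contains the integrability condition for `φ*`. As `Nil₃` is nilpotent,
`φ*` is integrated by applying the Poincaré lemma for real `1`-forms on simply connected domains
three times (`exists_phi_eq`); the Poincaré lemma itself comes from the lifting criterion for a
covering space with discrete fibre `F`, whose charts are the local primitives
(`exists_forall_eventually_sub_eq`).

Being a dual surface is thus equivalent to having Maurer–Cartan form `φ*` off the zeros of `B`
(`IsMinimalSpinors.isDualSurface_iff`). Applying the recipe twice returns `φ`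
(`IsMinimalSpinors.spinorVec_dual_dual`), and a surface is determined by its Maurer–Cartan form up
to one left translation, since the complement of the discrete zero set of `B` stays connected
(`exists_eq_nilMul`).
-/

noncomputable section

/-! ### Wirtinger calculus -/

/-- `F` is real differentiable at `z` with differential `p dz + q dz̄`. -/
def HasWirtingerAt (F : ℂ → ℂ) (p q z : ℂ) : Prop :=
  HasFDerivAt F (p • (1 : ℂ →L[ℝ] ℂ) + q • (Complex.conjCLE : ℂ →L[ℝ] ℂ)) z

namespace HasWirtingerAt

variable {F G : ℂ → ℂ} {p q p' q' z : ℂ}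

theorem fderiv_apply (h : HasWirtingerAt F p q z) (v : ℂ) :
    fderiv ℝ F z v = p * v + q * conj v := by
  rw [HasFDerivAt.fderiv h]; simp

theorem dz_eq (h : HasWirtingerAt F p q z) : dz F z = p := by
  simp only [dz, h.fderiv_apply, map_one, Complex.conj_I]
  linear_combination (-p / 2 + q / 2) * Complex.I_sq

theorem dzbar_eq (h : HasWirtingerAt F p q z) : dzbar F z = q := by
  simp only [dzbar, h.fderiv_apply, map_one, Complex.conj_I]
  linear_combination (p / 2 - q / 2) * Complex.I_sq

theorem differentiableAt (h : HasWirtingerAt F p q z) : DifferentiableAt ℝ F z :=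
  HasFDerivAt.differentiableAt h

theorem congr_of_eventuallyEq (h : HasWirtingerAt F p q z) (hG : G =ᶠ[𝓝 z] F) :
    HasWirtingerAt G p q z :=
  HasFDerivAt.congr_of_eventuallyEq h hG

theorem add (h : HasWirtingerAt F p q z) (h' : HasWirtingerAt G p' q' z) :
    HasWirtingerAt (fun w => F w + G w) (p + p') (q + q') z := by
  refine (HasFDerivAt.add h h').congr_fderiv ?_
  module

theorem sub (h : HasWirtingerAt F p q z) (h' : HasWirtingerAt G p' q' z) :
    HasWirtingerAt (fun w => F w - G w) (p - p') (q - q') z := by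
  refine (HasFDerivAt.sub h h').congr_fderiv ?_
  module

theorem mul (h : HasWirtingerAt F p q z) (h' : HasWirtingerAt G p' q' z) :
    HasWirtingerAt (fun w => F w * G w) (F z * p' + p * G z) (F z * q' + q * G z) z := by
  refine (HasFDerivAt.mul h h').congr_fderiv ?_
  ext
  simp
  ring

theorem const (c : ℂ) : HasWirtingerAt (fun _ => c) 0 0 z := by
  refine (hasFDerivAt_const c z).congr_fderiv ?_
  module

theorem const_mul (c : ℂ) (h : HasWirtingerAt F p q z) :
    HasWirtingerAt (fun w => c * F w) (c * p) (c * q) z := by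
  simpa using (const c).mul h

theorem neg (h : HasWirtingerAt F p q z) : HasWirtingerAt (fun w => -F w) (-p) (-q) z := by
  simpa using h.const_mul (-1)

theorem pow_two (h : HasWirtingerAt F p q z) :
    HasWirtingerAt (fun w => F w ^ 2) (2 * F z * p) (2 * F z * q) z := by
  simpa only [sq, two_mul, add_mul, mul_comm (F z)] using h.mul h

theorem star (h : HasWirtingerAt F p q z) :
    HasWirtingerAt (fun w => conj (F w)) (conj q) (conj p) z := by
  refine ((Complex.conjCLE : ℂ →L[ℝ] ℂ).hasFDerivAt.comp z h).congr_fderiv ?_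
  ext
  simp [add_comm]

/-- The chain rule for an outer holomorphic function. -/
theorem comp_hasDerivAt {g : ℂ → ℂ} {g' : ℂ} (hg : HasDerivAt g g' (F z))
    (h : HasWirtingerAt F p q z) : HasWirtingerAt (fun w => g (F w)) (g' * p) (g' * q) z := by
  refine ((hg.hasFDerivAt.restrictScalars ℝ).comp z h).congr_fderiv ?_
  ext
  simp
  ring

theorem inv (h : HasWirtingerAt F p q z) (hF : F z ≠ 0) :
    HasWirtingerAt (fun w => (F w)⁻¹) (-p / F z ^ 2) (-q / F z ^ 2) z := by
  have := comp_hasDerivAt (hasDerivAt_inv hF) h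
  convert this using 1 <;> ring

theorem div (h : HasWirtingerAt F p q z) (h' : HasWirtingerAt G p' q' z) (hG : G z ≠ 0) :
    HasWirtingerAt (fun w => F w / G w) (p / G z - F z * p' / G z ^ 2)
      (q / G z - F z * q' / G z ^ 2) z := by
  have := h.mul (h'.inv hG)
  simp only [div_eq_mul_inv] at this ⊢
  convert this using 1 <;> ring

theorem congr_coeff (h : HasWirtingerAt F p q z) (hp : p = p') (hq : q = q') :
    HasWirtingerAt F p' q' z := hp ▸ hq ▸ h

end HasWirtingerAt

theorem DifferentiableAt.hasWirtingerAt {F : ℂ → ℂ} {z : ℂ} (h : DifferentiableAt ℝ F z) :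
    HasWirtingerAt F (dz F z) (dzbar F z) z := by
  refine h.hasFDerivAt.congr_fderiv ?_
  ext v
  have hv : fderiv ℝ F z v = v.re * fderiv ℝ F z 1 + v.im * fderiv ℝ F z Complex.I := by
    conv_lhs => rw [← Complex.re_add_im v]
    rw [map_add, show (v.re : ℂ) = v.re • (1 : ℂ) by simp,
      show (v.im : ℂ) * Complex.I = v.im • Complex.I by simp, map_smul, map_smul]
    simp
  simp only [dz, dzbar, add_apply, smul_apply,
    one_apply_eq_self, ContinuousLinearEquiv.coe_coe, Complex.conjCLE_apply,
    smul_eq_mul, hv, Complex.re_eq_add_conj, Complex.im_eq_sub_conj]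
  have : Complex.I ≠ 0 := Complex.I_ne_zero
  field_simp
  linear_combination (fderiv ℝ F z Complex.I * (v - conj v)) * Complex.I_sq

theorem ContDiffOn.hasWirtingerAt {F : ℂ → ℂ} {D : Set ℂ} (hF : ContDiffOn ℝ ∞ F D)
    (hD : IsOpen D) {z : ℂ} (hz : z ∈ D) : HasWirtingerAt F (dz F z) (dzbar F z) z :=
  ((hF.contDiffAt (hD.mem_nhds hz)).differentiableAt (by simp)).hasWirtingerAt

theorem HasWirtingerAt.hasDerivAt {F : ℂ → ℂ} {p z : ℂ} (h : HasWirtingerAt F p 0 z) :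
    HasDerivAt F p z := by
  rw [hasDerivAt_iff_hasFDerivAt]
  refine hasFDerivAt_of_restrictScalars ℝ h ?_
  ext
  simp [mul_comm]

theorem HasDerivAt.hasWirtingerAt {F : ℂ → ℂ} {p z : ℂ} (h : HasDerivAt F p z) :
    HasWirtingerAt F p 0 z := by
  refine (h.hasFDerivAt.restrictScalars ℝ).congr_fderiv ?_
  ext
  simp [mul_comm]

section Smooth

variable {F : ℂ → ℂ} {D : Set ℂ}

theorem ContDiffOn.fderiv_apply_of_isOpen {E : Type*} [NormedAddCommGroup E] [NormedSpace ℝ E]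
    {F : ℂ → E} (hF : ContDiffOn ℝ ∞ F D) (hD : IsOpen D) (v : ℂ) :
    ContDiffOn ℝ ∞ (fun z => fderiv ℝ F z v) D :=
  ((contDiffOn_infty_iff_fderiv_of_isOpen hD).mp hF).2.clm_apply contDiffOn_const

theorem ContDiffOn.dz (hF : ContDiffOn ℝ ∞ F D) (hD : IsOpen D) : ContDiffOn ℝ ∞ (dz F) D :=
  contDiffOn_const.mul ((hF.fderiv_apply_of_isOpen hD 1).sub
    (contDiffOn_const.mul (hF.fderiv_apply_of_isOpen hD Complex.I)))

theorem ContDiffOn.dzbar (hF : ContDiffOn ℝ ∞ F D) (hD : IsOpen D) :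
    ContDiffOn ℝ ∞ (dzbar F) D :=
  contDiffOn_const.mul ((hF.fderiv_apply_of_isOpen hD 1).add
    (contDiffOn_const.mul (hF.fderiv_apply_of_isOpen hD Complex.I)))

theorem dzbar_dz (hF : ContDiffOn ℝ ∞ F D) (hD : IsOpen D) {z : ℂ} (hz : z ∈ D) :
    dzbar (dz F) z = dz (dzbar F) z := by
  have hd : ∀ v, DifferentiableAt ℝ (fun w => fderiv ℝ F w v) z := fun v =>
    ((hF.fderiv_apply_of_isOpen hD v).contDiffAt (hD.mem_nhds hz)).differentiableAt (by simp)
  have h2 : ∀ u v, fderiv ℝ (fun w => fderiv ℝ F w v) z u = fderiv ℝ (fderiv ℝ F) z u v := by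
    intro u v
    have h := (((contDiffOn_infty_iff_fderiv_of_isOpen hD).mp hF).2.contDiffAt
      (hD.mem_nhds hz)).differentiableAt (by simp)
    rw [fderiv_clm_apply h (differentiableAt_const v)]
    simp
  have hsymm := (hF.contDiffAt (hD.mem_nhds hz)).isSymmSndFDerivAt
    (by simp only [minSmoothness_of_isRCLikeNormedField]; exact WithTop.coe_le_coe.mpr le_top)
  have h1 := hd 1
  have hI := hd Complex.I
  have e1 : HasWirtingerAt (dz F) _ _ z :=
    (h1.hasWirtingerAt.sub (hI.hasWirtingerAt.const_mul Complex.I)).const_mul (1 / 2)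
  have e2 : HasWirtingerAt (dzbar F) _ _ z :=
    (h1.hasWirtingerAt.add (hI.hasWirtingerAt.const_mul Complex.I)).const_mul (1 / 2)
  rw [e1.dzbar_eq, e2.dz_eq]
  simp only [dz, dzbar, h2]
  rw [hsymm.eq Complex.I 1]
  ring

end Smooth

/-- The differential of a real function is `2 Re (θ dz)`. -/
theorem hasWirtingerAt_ofReal_iff {x : ℂ → ℝ} {θ z : ℂ} :
    HasWirtingerAt (fun w => (x w : ℂ)) θ (conj θ) z ↔
      HasFDerivAt x ((2 : ℝ) • Complex.reCLM ∘L (θ • (1 : ℂ →L[ℝ] ℂ))) z := by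
  constructor
  · intro h
    refine (Complex.reCLM.hasFDerivAt.comp z h).congr_fderiv ?_
    apply ContinuousLinearMap.ext
    intro v
    simp
    ring
  · intro h
    refine (Complex.ofRealCLM.hasFDerivAt.comp z h).congr_fderiv ?_
    apply ContinuousLinearMap.ext
    intro v
    apply Complex.ext
    · simp
      ring
    · simp
      ring

theorem dzbar_ofReal {x : ℂ → ℝ} {z : ℂ} (h : DifferentiableAt ℝ x z) :
    dzbar (fun w => (x w : ℂ)) z = conj (dz (fun w => (x w : ℂ)) z) := by
  have h1 : ∀ v, fderiv ℝ (fun w => (x w : ℂ)) z v = (fderiv ℝ x z v : ℂ) := fun v => by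
    have h2 : HasFDerivAt (fun w => (x w : ℂ)) (Complex.ofRealCLM ∘L fderiv ℝ x z) z :=
      Complex.ofRealCLM.hasFDerivAt.comp z h.hasFDerivAt
    rw [h2.fderiv]
    simp
  simp [dz, dzbar, h1, Complex.conj_ofNat]

theorem DifferentiableAt.hasWirtingerAt_ofReal {x : ℂ → ℝ} {z : ℂ} (h : DifferentiableAt ℝ x z) :
    HasWirtingerAt (fun w => (x w : ℂ)) (dz (fun w => (x w : ℂ)) z)
      (conj (dz (fun w => (x w : ℂ)) z)) z := by
  rw [← dzbar_ofReal h]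
  exact (Complex.ofRealCLM.differentiableAt.comp z h : DifferentiableAt ℝ
    (fun w => (x w : ℂ)) z).hasWirtingerAt

/-! ### The Poincaré lemma on simply connected domains -/

/-- A family of local functions whose differences are locally constant glues, on a simply connected
space, to one global function, up to locally constant functions. The local functions
`F x + v`, `v ∈ G`, are the charts of a covering space with fibre `G` (discrete), and a section of
this covering, which exists by the lifting criterion, is the global function. -/
theorem exists_forall_eventually_sub_eq {X G : Type*} [TopologicalSpace X] [SimplyConnectedSpace X]
    [LocallyPathConnectedSpace X] [AddCommGroup G] (U : X → Set X) (hU : ∀ x, IsOpen (U x))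
    (hxU : ∀ x, x ∈ U x) (F : X → X → G)
    (hF : ∀ x y, ∀ z ∈ U x ∩ U y, ∀ᶠ w in 𝓝 z, F x w - F y w = F x z - F y z) :
    ∃ P : X → G, ∀ x, ∀ᶠ w in 𝓝 x, P w - F x w = P x - F x x := by
  let _ : TopologicalSpace G := ⊥
  have : DiscreteTopology G := ⟨rfl⟩
  let Z : FiberBundleCore X X G :=
    { baseSet := U
      isOpen_baseSet := hU
      indexAt := id
      mem_baseSet_at := hxU
      coordChange := fun x y z v => v + (F x z - F y z)
      coordChange_self := fun x z _ v => by simp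
      continuousOn_coordChange := fun x y => by
        rintro ⟨z, v⟩ ⟨hz, -⟩
        refine ContinuousAt.continuousWithinAt ?_
        have h1 : ContinuousAt (fun w => F x w - F y w) z :=
          continuousAt_const.congr ((hF x y z hz).mono fun w hw => hw.symm)
        exact continuousAt_snd.add
          (ContinuousAt.comp (f := Prod.fst) (x := (z, v)) h1 continuousAt_fst)
      coordChange_comp := fun x y w z _ v => by abel }
  have hcov : IsCoveringMap Z.proj := FiberBundle.isCoveringMap (F := G) (E := Z.Fiber)
  obtain ⟨x₀⟩ : Nonempty X := inferInstance
  obtain ⟨σ, ⟨-, hσ⟩, -⟩ := hcov.existsUnique_continuousMap_lifts (ContinuousMap.id X) x₀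
    (⟨x₀, (0 : G)⟩ : Z.TotalSpace) rfl
  have hσ' : ∀ x, (σ x).1 = x := fun x => congr_fun hσ x
  let v : X → G := fun w => (σ w).2
  have key : ∀ x w, (Z.localTriv x (σ w)).2 = v w + (F w w - F x w) := by
    intro x w
    rw [Z.localTriv_apply]
    change v w + (F (σ w).1 (σ w).1 - F x (σ w).1) = _
    rw [hσ']
  refine ⟨fun w => v w + F w w, fun x => ?_⟩
  have hc : ContinuousAt (fun w => (Z.localTriv x (σ w)).2) x := by
    refine continuousAt_snd.comp (ContinuousAt.comp (f := σ) ?_ σ.continuous.continuousAt)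
    refine (Z.localTriv x).continuousAt ?_
    rw [Z.mem_localTriv_source, ← Z.baseSet_at, hσ']
    exact hxU x
  rw [ContinuousAt, nhds_discrete G, Filter.tendsto_pure] at hc
  filter_upwards [hc] with w hw
  rw [key, key] at hw
  rw [add_sub_assoc, hw, add_sub_assoc]

/-- The Poincaré lemma for `1`-forms on a simply connected open set: a closed form is exact. -/
theorem exists_forall_hasFDerivAt_of_simplyConnected {E F : Type*} [NormedAddCommGroup E]
    [NormedSpace ℝ E] [NormedAddCommGroup F] [NormedSpace ℝ F] [CompleteSpace F] {D : Set E}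
    (hD : IsOpen D) [SimplyConnectedSpace D] {η : E → E →L[ℝ] F} (hη : DifferentiableOn ℝ η D)
    (hdη : ∀ a ∈ D, ∀ x y, fderiv ℝ η a x y = fderiv ℝ η a y x) :
    ∃ f : E → F, ∀ a ∈ D, HasFDerivAt f (η a) a := by
  have := hD.locallyPathConnectedSpace
  have hr : ∀ x : D, ∃ r > 0, Metric.ball (x : E) r ⊆ D := fun x =>
    Metric.isOpen_iff.mp hD x x.2
  choose r hr0 hrD using hr
  have hloc : ∀ x : D, ∃ f : E → F, ∀ a ∈ Metric.ball (x : E) (r x), HasFDerivAt f (η a) a :=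
    fun x => (convex_ball _ _).exists_forall_hasFDerivAt_of_fderiv_symmetric Metric.isOpen_ball
      (hη.mono (hrD x)) fun a ha => hdη a (hrD x ha)
  choose f hf using hloc
  obtain ⟨P, hP⟩ := exists_forall_eventually_sub_eq (X := D) (G := F)
    (fun x => Subtype.val ⁻¹' Metric.ball (x : E) (r x))
    (fun x => Metric.isOpen_ball.preimage continuous_subtype_val)
    (fun x => Metric.mem_ball_self (hr0 x)) (fun x w => f x w) (by
      rintro x y z ⟨hx, hy⟩
      obtain ⟨ε, hε, hsub⟩ := Metric.isOpen_iff.mp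
        ((Metric.isOpen_ball (x := (x : E)) (ε := r x)).inter
          (Metric.isOpen_ball (x := (y : E)) (ε := r y))) z ⟨hx, hy⟩
      have hd : ∀ a ∈ Metric.ball (z : E) ε, HasFDerivAt (fun w => f x w - f y w) 0 a :=
        fun a ha =>
          ((hf x a (hsub ha).1).fun_sub (hf y a (hsub ha).2)).congr_fderiv (sub_self _)
      obtain ⟨c, hc⟩ := Metric.isOpen_ball.exists_is_const_of_fderiv_eq_zero
        (convex_ball (z : E) ε).isPreconnected
        (fun a ha => (hd a ha).differentiableAt.differentiableWithinAt)
        (fun a ha => (hd a ha).fderiv)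
      have hnear : ∀ᶠ w : D in 𝓝 z, (w : E) ∈ Metric.ball (z : E) ε :=
        continuous_subtype_val.continuousAt.eventually (Metric.ball_mem_nhds (z : E) hε)
      filter_upwards [hnear] with w hw
      exact (hc w hw).trans (hc z (Metric.mem_ball_self hε)).symm)
  classical
  refine ⟨fun z => if h : z ∈ D then P ⟨z, h⟩ else 0, fun a ha => ?_⟩
  have hPa := hP ⟨a, ha⟩
  have hE : ∀ᶠ w in 𝓝 a, (if h : w ∈ D then P ⟨w, h⟩ else 0) =
      f ⟨a, ha⟩ w + (P ⟨a, ha⟩ - f ⟨a, ha⟩ a) := by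
    rw [← hD.isOpenEmbedding_subtypeVal.map_nhds_eq ⟨a, ha⟩, Filter.eventually_map]
    filter_upwards [hPa] with w hw
    rw [dif_pos w.2, ← hw]
    abel
  exact ((hf ⟨a, ha⟩ a (Metric.mem_ball_self (hr0 _))).add_const _).congr_of_eventuallyEq hE

/-- The Poincaré lemma for real `1`-forms `2 Re (θ dz)`: such a form is closed if and only if
`∂θ/∂z̄` is real. -/
theorem exists_hasWirtingerAt_ofReal {D : Set ℂ} (hD : IsOpen D) [SimplyConnectedSpace D]
    {θ : ℂ → ℂ} (hθ : ContDiffOn ℝ ∞ θ D) (hreal : ∀ z ∈ D, conj (dzbar θ z) = dzbar θ z) :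
    ∃ x : ℂ → ℝ, ContDiffOn ℝ ∞ x D ∧
      ∀ z ∈ D, HasWirtingerAt (fun w => (x w : ℂ)) (θ z) (conj (θ z)) z := by
  let L : ℂ →L[ℝ] ℂ →L[ℝ] ℝ :=
    (2 : ℝ) • (ContinuousLinearMap.compL ℝ ℂ ℂ ℝ Complex.reCLM) ∘L ContinuousLinearMap.mul ℝ ℂ
  have hL : ∀ p v, L p v = 2 * (p * v).re := fun p v => by simp [L]
  have hη : ContDiffOn ℝ ∞ (fun z => L (θ z)) D := L.contDiff.comp_contDiffOn hθ
  obtain ⟨x, hx⟩ := exists_forall_hasFDerivAt_of_simplyConnected hD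
    (hη.differentiableOn (by simp)) (fun a ha u v => by
      have hW := hθ.hasWirtingerAt hD ha
      have hd : ∀ u, fderiv ℝ (fun z => L (θ z)) a u = L (fderiv ℝ θ a u) := fun u => by
        have hc : HasFDerivAt (fun z => L (θ z)) (L ∘L fderiv ℝ θ a) a :=
          L.hasFDerivAt.comp a hW.differentiableAt.hasFDerivAt
        rw [hc.fderiv]
        rfl
      have hq := (Complex.conj_eq_iff_im.mp (hreal a ha))
      rw [hd, hd, hL, hL, hW.fderiv_apply, hW.fderiv_apply]
      simp [hq]
      ring)
  refine ⟨x, ?_, fun z hz => ?_⟩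
  · rw [contDiffOn_infty_iff_fderiv_of_isOpen hD]
    exact ⟨fun z hz => (hx z hz).differentiableAt.differentiableWithinAt,
      hη.congr fun z hz => (hx z hz).fderiv⟩
  · rw [hasWirtingerAt_ofReal_iff]
    refine (hx z hz).congr_fderiv ?_
    ext v
    simp [hL]

/-! ### The Maurer–Cartan form of a surface -/

theorem leftVel_one (f : ℂ → R3) (z : ℂ) (k : Fin 3) :
    (leftVel f 1 z k : ℂ) = phi f z k + conj (phi f z k) := by
  simp [phi, Complex.conj_ofNat]
  ring

theorem leftVel_I (f : ℂ → R3) (z : ℂ) (k : Fin 3) :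
    (leftVel f Complex.I z k : ℂ) = Complex.I * (phi f z k - conj (phi f z k)) := by
  simp only [phi, map_mul, map_sub, Complex.conj_ofReal, Complex.conj_I, map_div₀, map_one,
    Complex.conj_ofNat]
  linear_combination (leftVel f Complex.I z k : ℂ) * Complex.I_sq

theorem ofReal_fderiv_apply {W : ℂ → R3} {z : ℂ} (h : DifferentiableAt ℝ W z) (v : ℂ) (k : Fin 3) :
    ((fderiv ℝ W z v k : ℝ) : ℂ) = fderiv ℝ (fun w => (W w k : ℂ)) z v := by
  have h1 : HasFDerivAt (fun w => W w k) ((ContinuousLinearMap.proj k) ∘L fderiv ℝ W z) z :=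
    (hasFDerivAt_pi'.mp h.hasFDerivAt) k
  have h2 : HasFDerivAt (fun w => (W w k : ℂ))
      (Complex.ofRealCLM ∘L (ContinuousLinearMap.proj k) ∘L fderiv ℝ W z) z :=
    Complex.ofRealCLM.hasFDerivAt.comp z h1
  rw [h2.fderiv]
  simp

section Phi

variable {f : ℂ → R3} {z : ℂ} (h : DifferentiableAt ℝ f z)
include h

theorem phi_zero : phi f z 0 = dz (fun w => (f w 0 : ℂ)) z := by
  simp [phi, leftVel, leftTriv, dz, ofReal_fderiv_apply h]

theorem phi_one : phi f z 1 = dz (fun w => (f w 1 : ℂ)) z := by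
  simp [phi, leftVel, leftTriv, dz, ofReal_fderiv_apply h]

theorem phi_two : phi f z 2 = dz (fun w => (f w 2 : ℂ)) z +
    (1 / 2) * (f z 1 * dz (fun w => (f w 0 : ℂ)) z - f z 0 * dz (fun w => (f w 1 : ℂ)) z) := by
  simp [phi, leftVel, leftTriv, dz, ofReal_fderiv_apply h]
  ring

end Phi

theorem contDiffOn_ofReal_apply {D : Set ℂ} {f : ℂ → R3} (hf : ContDiffOn ℝ ∞ f D) (k : Fin 3) :
    ContDiffOn ℝ ∞ (fun w => (f w k : ℂ)) D :=
  Complex.ofRealCLM.contDiff.comp_contDiffOn (contDiffOn_pi.mp hf k)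

theorem contDiffOn_leftVel {D : Set ℂ} (hD : IsOpen D) {f : ℂ → R3} (hf : ContDiffOn ℝ ∞ f D)
    (v : ℂ) : ContDiffOn ℝ ∞ (leftVel f v) D := by
  have h1 := contDiffOn_pi.mp hf
  have h2 := contDiffOn_pi.mp (hf.fderiv_apply_of_isOpen hD v)
  rw [contDiffOn_pi]
  intro k
  fin_cases k
  · exact h2 0
  · exact h2 1
  · exact (h2 2).add (contDiffOn_const.mul (((h1 1).mul (h2 0)).sub ((h1 0).mul (h2 1))))

theorem contDiffOn_phi {D : Set ℂ} (hD : IsOpen D) {f : ℂ → R3} (hf : ContDiffOn ℝ ∞ f D)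
    (k : Fin 3) : ContDiffOn ℝ ∞ (fun w => phi f w k) D :=
  contDiffOn_const.mul ((contDiffOn_ofReal_apply (contDiffOn_leftVel hD hf 1) k).sub
    (contDiffOn_const.mul (contDiffOn_ofReal_apply (contDiffOn_leftVel hD hf Complex.I) k)))

/-- The left translation of `∇_{∂z̄} f_z`. For an immersion this is a multiple of the mean
curvature vector; it vanishes when `f` is minimal. -/
def tension (f : ℂ → R3) (z : ℂ) : Fin 3 → ℂ :=
  fun k => dzbar (fun w => phi f w k) z + nilConn (fun j => conj (phi f z j)) (phi f z) k

/-- By the symmetry of second derivatives, `∂²x/∂z̄∂z` is real for a real function `x`. -/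
theorem conj_dzbar_dz_ofReal {D : Set ℂ} (hD : IsOpen D) {x : ℂ → ℝ} (hx : ContDiffOn ℝ ∞ x D)
    {z : ℂ} (hz : z ∈ D) :
    conj (dzbar (dz fun w => (x w : ℂ)) z) = dzbar (dz fun w => (x w : ℂ)) z := by
  have hX : ContDiffOn ℝ ∞ (fun w => (x w : ℂ)) D := Complex.ofRealCLM.contDiff.comp_contDiffOn hx
  have h1 := ((hX.dz hD).hasWirtingerAt hD hz).star
  have h2 : HasWirtingerAt (dzbar fun w => (x w : ℂ)) _ _ z := h1.congr_of_eventuallyEq (by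
    filter_upwards [hD.mem_nhds hz] with w hw using
      dzbar_ofReal ((hx.contDiffAt (hD.mem_nhds hw)).differentiableAt (by simp)))
  rw [← h2.dz_eq, dzbar_dz hX hD hz]

section Smooth

variable {D : Set ℂ} (hD : IsOpen D) {f : ℂ → R3} (hf : ContDiffOn ℝ ∞ f D) {z : ℂ} (hz : z ∈ D)
include hD hf hz

theorem ContDiffOn.differentiableAt_of_isOpen : DifferentiableAt ℝ f z :=
  (hf.contDiffAt (hD.mem_nhds hz)).differentiableAt (by simp)

/-- The Maurer–Cartan equation, which says that `∇_{∂z̄} f_z` is real (the connection is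
torsion-free). -/
theorem conj_tension (k : Fin 3) : conj (tension f z k) = tension f z k := by
  have hX := fun k => contDiffOn_ofReal_apply hf k
  have hfd := fun {w} (hw : w ∈ D) => hf.differentiableAt_of_isOpen hD hw
  have hr := fun k => conj_dzbar_dz_ofReal hD (contDiffOn_pi.mp hf k) hz
  have hX' := fun k => (((contDiffOn_pi.mp hf k).contDiffAt
    (hD.mem_nhds hz)).differentiableAt (by simp)).hasWirtingerAt_ofReal
  have hP := fun k => ((hX k).dz hD).hasWirtingerAt hD hz
  have h0 : HasWirtingerAt (fun w => phi f w 0) _ _ z := (hP 0).congr_of_eventuallyEq (by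
    filter_upwards [hD.mem_nhds hz] with w hw using phi_zero (hfd hw))
  have h1 : HasWirtingerAt (fun w => phi f w 1) _ _ z := (hP 1).congr_of_eventuallyEq (by
    filter_upwards [hD.mem_nhds hz] with w hw using phi_one (hfd hw))
  have h2 : HasWirtingerAt (fun w => phi f w 2) _ _ z := ((hP 2).add ((((hX' 1).mul (hP 0)).sub
    ((hX' 0).mul (hP 1))).const_mul (1 / 2))).congr_of_eventuallyEq (by
    filter_upwards [hD.mem_nhds hz] with w hw using phi_two (hfd hw))
  fin_cases k
  · simp only [tension, nilConn, Fin.zero_eta, h0.dzbar_eq, Matrix.cons_val_zero, map_add, hr,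
      map_div₀, map_mul, Complex.conj_conj, Complex.conj_ofNat]
    ring
  · simp only [tension, nilConn, Fin.mk_one, h1.dzbar_eq, Matrix.cons_val_one,
      Matrix.cons_val_zero, map_add, hr, map_neg, map_div₀, map_mul, Complex.conj_conj,
      Complex.conj_ofNat]
    ring
  · simp only [tension, nilConn, Fin.reduceFinMk, h2.dzbar_eq, Matrix.cons_val, map_add, map_sub,
      hr, map_div₀, map_mul, Complex.conj_conj, Complex.conj_ofNat, Complex.conj_ofReal, map_one,
      phi_zero (hfd hz), phi_one (hfd hz)]
    ring

theorem covDeriv_add_covDeriv (k : Fin 3) :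
    (((covDeriv f 1 (leftVel f 1) z + covDeriv f Complex.I (leftVel f Complex.I) z) k : ℝ) : ℂ) =
      4 * tension f z k := by
  have hφ := fun k => (contDiffOn_phi hD hf k).hasWirtingerAt hD hz
  have hd := fun v => (contDiffOn_leftVel hD hf v).differentiableAt_of_isOpen hD hz
  have h1 : HasWirtingerAt (fun w => (leftVel f 1 w k : ℂ)) _ _ z := ((hφ k).add
    (hφ k).star).congr_of_eventuallyEq (.of_forall fun w => leftVel_one f w k)
  have h2 : HasWirtingerAt (fun w => (leftVel f Complex.I w k : ℂ)) _ _ z := (((hφ k).sub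
    (hφ k).star).const_mul Complex.I).congr_of_eventuallyEq (.of_forall fun w => leftVel_I f w k)
  have ht : 4 * tension f z k = 2 * (tension f z k + conj (tension f z k)) := by
    rw [conj_tension hD hf hz]
    ring
  have hn : ∀ v : ℂ, ((nilConn (leftVel f v z) (leftVel f v z) k : ℝ) : ℂ) =
      nilConn (fun j => (leftVel f v z j : ℂ)) (fun j => (leftVel f v z j : ℂ)) k := by
    intro v
    fin_cases k <;> simp [nilConn]
  rw [ht]
  simp only [covDeriv, Pi.add_apply, Complex.ofReal_add, ofReal_fderiv_apply (hd _), hn,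
    h1.fderiv_apply, h2.fderiv_apply, map_one, Complex.conj_I]
  simp only [leftVel_one, leftVel_I, tension, map_add]
  have hI := Complex.I_sq
  generalize dz (fun w => phi f w k) z = p
  generalize dzbar (fun w => phi f w k) z = q
  generalize phi f z = φ
  fin_cases k
  · simp only [nilConn, Fin.zero_eta, Matrix.cons_val, map_div₀, map_mul, map_add,
      Complex.conj_conj, Complex.conj_ofNat]
    linear_combination (p - conj q - q + conj p +
      (φ 1 - conj (φ 1)) * (φ 2 - conj (φ 2))) * hI
  · simp only [nilConn, Fin.mk_one, Matrix.cons_val, map_neg, map_div₀, map_mul, map_add,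
      Complex.conj_conj, Complex.conj_ofNat]
    linear_combination (p - conj q - q + conj p -
      (φ 0 - conj (φ 0)) * (φ 2 - conj (φ 2))) * hI
  · simp only [nilConn, Fin.reduceFinMk, Matrix.cons_val, map_div₀, map_mul, map_sub,
      Complex.conj_conj, Complex.conj_ofNat]
    linear_combination (p - conj q - q + conj p) * hI

end Smooth

/-! ### Spinors at a point -/

/-- The normal direction determined by a pair of spinors, of length `|a|² + |b|²`. -/
def spinorNormal (a b : ℂ) : R3 :=
  ![2 * (a * b).re, 2 * (a * b).im, Complex.normSq a - Complex.normSq b]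

/-- The length of `spinorNormal a b`. -/
def spinorLen (a b : ℂ) : ℝ := Complex.normSq a + Complex.normSq b

theorem spinorLen_nonneg (a b : ℂ) : 0 ≤ spinorLen a b :=
  add_nonneg (Complex.normSq_nonneg a) (Complex.normSq_nonneg b)

theorem spinorLen_pos {a b : ℂ} (h : Complex.normSq a - Complex.normSq b ≠ 0) :
    0 < spinorLen a b := by
  refine (spinorLen_nonneg a b).lt_of_ne fun h0 => h ?_
  have ha := Complex.normSq_nonneg a
  have hb := Complex.normSq_nonneg b
  unfold spinorLen at h0
  linarith

theorem spinorNormal_dotProduct_self (a b : ℂ) :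
    spinorNormal a b ⬝ᵥ spinorNormal a b = spinorLen a b ^ 2 := by
  simp [spinorNormal, spinorLen, dotProduct, Fin.sum_univ_three, Complex.normSq_apply]
  ring

theorem ofReal_spinorLen (a b : ℂ) : (spinorLen a b : ℂ) = a * conj a + b * conj b := by
  simp [spinorLen, Complex.mul_conj]

theorem ofReal_spinorNormal (a b : ℂ) (k : Fin 3) : (spinorNormal a b k : ℂ) =
    ![a * b + conj a * conj b, -Complex.I * (a * b - conj a * conj b),
      a * conj a - b * conj b] k := by
  have hI := Complex.I_ne_zero
  fin_cases k
  · simp only [spinorNormal, Fin.zero_eta, Matrix.cons_val, Complex.ofReal_mul,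
      Complex.re_eq_add_conj, map_mul, Complex.ofReal_ofNat]
    ring
  · simp only [spinorNormal, Fin.mk_one, Matrix.cons_val, Complex.ofReal_mul,
      Complex.im_eq_sub_conj, map_mul, Complex.ofReal_ofNat]
    field_simp
    linear_combination (a * b - conj a * conj b) * Complex.I_sq
  · simp [spinorNormal, Complex.mul_conj]

/-- Spinors of the opposite orientation. -/
theorem neg_spinorVec (a b : ℂ) :
    -spinorVec a b = spinorVec (Complex.I * a) (-Complex.I * b) := by
  have hI := Complex.I_sq
  ext k
  fin_cases k
  · simp [spinorVec, mul_pow]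
    ring
  · simp [spinorVec, mul_pow]
    ring
  · simp [spinorVec]
    linear_combination (-2 * a * conj b) * hI

theorem spinorNormal_I_mul (a b : ℂ) :
    spinorNormal (Complex.I * a) (-Complex.I * b) = spinorNormal a b := by
  have h : Complex.I * a * (-Complex.I * b) = a * b := by
    linear_combination (-a * b) * Complex.I_sq
  simp only [spinorNormal, h]
  simp

theorem spinorLen_I_mul (a b : ℂ) :
    spinorLen (Complex.I * a) (-Complex.I * b) = spinorLen a b := by
  simp [spinorLen]

theorem sum_norm_sq_spinorVec (a b : ℂ) : ∑ k, ‖spinorVec a b k‖ ^ 2 = 2 * spinorLen a b ^ 2 := by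
  simp only [spinorVec, Fin.sum_univ_three, Matrix.cons_val, ← Complex.normSq_eq_norm_sq,
    spinorLen]
  simp [Complex.normSq_apply, sq]
  ring

theorem sum_spinorVec_mul_spinorNormal (a b : ℂ) :
    ∑ k, spinorVec a b k * (spinorNormal a b k : ℂ) = 0 := by
  simp only [ofReal_spinorNormal, spinorVec, Fin.sum_univ_three, Matrix.cons_val]
  linear_combination -(conj b ^ 2 + a ^ 2) * (a * b - conj a * conj b) * Complex.I_sq

theorem leftVel_one_eq (f : ℂ → R3) (z : ℂ) (k : Fin 3) :
    leftVel f 1 z k = 2 * (phi f z k).re := by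
  simp [phi]

theorem leftVel_I_eq (f : ℂ → R3) (z : ℂ) (k : Fin 3) :
    leftVel f Complex.I z k = -2 * (phi f z k).im := by
  simp [phi]

theorem orient_eq_dotProduct (f N : ℂ → R3) (z : ℂ) :
    orient f N z = (leftVel f 1 z ⨯₃ leftVel f Complex.I z) ⬝ᵥ N z := by
  rw [orient]
  refine (Matrix.det_fin_three _).trans ?_
  simp [crossProduct, dotProduct, Fin.sum_univ_three]
  ring

theorem orient_unitNormal_nonneg (f : ℂ → R3) (z : ℂ) : 0 ≤ orient f (unitNormal f) z := by
  rw [orient_eq_dotProduct, unitNormal, dotProduct_smul, smul_eq_mul]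
  refine mul_nonneg (inv_nonneg.mpr (Real.sqrt_nonneg _)) ?_
  exact Finset.sum_nonneg fun i _ => mul_self_nonneg _

theorem isUnitNormal_iff {D : Set ℂ} {f N : ℂ → R3} : IsUnitNormal D f N ↔
    ∀ z ∈ D, N z ⬝ᵥ N z = 1 ∧ ∑ k, phi f z k * (N z k : ℂ) = 0 := by
  refine forall₂_congr fun z _ => and_congr_right fun _ => ?_
  have h1 : N z ⬝ᵥ leftVel f 1 z = 2 * (∑ k, phi f z k * (N z k : ℂ)).re := by
    simp only [dotProduct, leftVel_one_eq, Complex.re_sum, Complex.re_mul_ofReal, Finset.mul_sum]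
    exact Finset.sum_congr rfl fun k _ => by ring
  have h2 : N z ⬝ᵥ leftVel f Complex.I z = -2 * (∑ k, phi f z k * (N z k : ℂ)).im := by
    simp only [dotProduct, leftVel_I_eq, Complex.im_sum, Complex.im_mul_ofReal, Finset.mul_sum]
    exact Finset.sum_congr rfl fun k _ => by ring
  rw [h1, h2, Complex.ext_iff]
  simp

section Point

variable {f : ℂ → R3} {z a b : ℂ} (h : phi f z = spinorVec a b)
include h

theorem confFactor_eq : confFactor f z = 4 * spinorLen a b ^ 2 := by
  rw [confFactor, h, sum_norm_sq_spinorVec]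
  ring

theorem leftVel_cross_leftVel :
    leftVel f 1 z ⨯₃ leftVel f Complex.I z = (4 * spinorLen a b) • spinorNormal a b := by
  have hx : leftVel f 1 z = fun k => 2 * (spinorVec a b k).re := by
    ext k
    rw [leftVel_one_eq, h]
  have hy : leftVel f Complex.I z = fun k => -2 * (spinorVec a b k).im := by
    ext k
    rw [leftVel_I_eq, h]
  rw [hx, hy]
  ext k
  fin_cases k <;> simp [crossProduct, spinorVec, spinorNormal, spinorLen, Complex.normSq_apply, sq]
    <;> ring

theorem orient_eq (N : ℂ → R3) :
    orient f N z = 4 * spinorLen a b * (spinorNormal a b ⬝ᵥ N z) := by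
  rw [orient_eq_dotProduct, leftVel_cross_leftVel h, smul_dotProduct, smul_eq_mul]

theorem unitNormal_eq : unitNormal f z = (spinorLen a b)⁻¹ • spinorNormal a b := by
  have hr := spinorLen_nonneg a b
  have hs : Real.sqrt ((4 * spinorLen a b) • spinorNormal a b ⬝ᵥ
      (4 * spinorLen a b) • spinorNormal a b) = 4 * spinorLen a b ^ 2 := by
    rw [smul_dotProduct, dotProduct_smul, spinorNormal_dotProduct_self, smul_eq_mul, smul_eq_mul,
      show 4 * spinorLen a b * (4 * spinorLen a b * spinorLen a b ^ 2) =
        (4 * spinorLen a b ^ 2) ^ 2 by ring, Real.sqrt_sq (by positivity)]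
  rw [unitNormal]
  simp only [leftVel_cross_leftVel h, hs, smul_smul]
  congr 1
  rcases hr.eq_or_lt with h0 | h0
  · simp [← h0]
  · field_simp

theorem sqrt_confFactor : Real.sqrt (confFactor f z) = 2 * spinorLen a b := by
  have hr := spinorLen_nonneg a b
  rw [confFactor_eq h, show 4 * spinorLen a b ^ 2 = (2 * spinorLen a b) ^ 2 by ring,
    Real.sqrt_sq (by positivity)]

theorem support_eq :
    support f (unitNormal f) z = 2 * (Complex.normSq a - Complex.normSq b) := by
  rw [support, sqrt_confFactor h, unitNormal_eq h]
  rcases (spinorLen_nonneg a b).eq_or_lt with h0 | h0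
  · have ha := Complex.normSq_nonneg a
    have hb := Complex.normSq_nonneg b
    have h1 : Complex.normSq a = 0 := by unfold spinorLen at h0; linarith
    have h2 : Complex.normSq b = 0 := by unfold spinorLen at h0; linarith
    simp [← h0, h1, h2]
  · simp [spinorNormal]
    field_simp

theorem sum_phi_mul_unitNormal : ∑ k, phi f z k * (unitNormal f z k : ℂ) = 0 := by
  have := sum_spinorVec_mul_spinorNormal a b
  rw [h, unitNormal_eq h]
  calc ∑ k, spinorVec a b k * (((spinorLen a b)⁻¹ • spinorNormal a b) k : ℝ)
      = ((spinorLen a b)⁻¹ : ℝ) * ∑ k, spinorVec a b k * (spinorNormal a b k : ℂ) := by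
        rw [Finset.mul_sum]
        exact Finset.sum_congr rfl fun k _ => by simp; ring
    _ = 0 := by rw [this, mul_zero]

theorem unitNormal_dotProduct_self (hr : spinorLen a b ≠ 0) :
    unitNormal f z ⬝ᵥ unitNormal f z = 1 := by
  rw [unitNormal_eq h, smul_dotProduct, dotProduct_smul, spinorNormal_dotProduct_self, smul_eq_mul,
    smul_eq_mul]
  field_simp

theorem orient_unitNormal_pos (hr : spinorLen a b ≠ 0) : 0 < orient f (unitNormal f) z := by
  have h0 : 0 < spinorLen a b := (spinorLen_nonneg a b).lt_of_ne' hr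
  rw [orient_eq h, unitNormal_eq h, dotProduct_smul, spinorNormal_dotProduct_self, smul_eq_mul]
  positivity

end Point

/-! ### The Dirac equation -/

theorem meanCurv_eq_zero {D : Set ℂ} (hD : IsOpen D) {f : ℂ → R3} (hf : ContDiffOn ℝ ∞ f D)
    {z : ℂ} (hz : z ∈ D) (ht : tension f z = 0) (N : ℂ → R3) : meanCurv f N z = 0 := by
  have h0 : covDeriv f 1 (leftVel f 1) z + covDeriv f Complex.I (leftVel f Complex.I) z = 0 := by
    ext k
    have := covDeriv_add_covDeriv hD hf hz k
    rw [ht, Pi.zero_apply, mul_zero, Complex.ofReal_eq_zero] at this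
    exact this
  rw [meanCurv, h0]
  simp

/-- A minimal surface is a harmonic map: the tension field is real, orthogonal to the isotropic
vector `f⁻¹ f_z` by conformality, and orthogonal to the normal by minimality. -/
theorem tension_eq_zero {D : Set ℂ} (hD : IsOpen D) {f : ℂ → R3} (hf : ContDiffOn ℝ ∞ f D)
    {z : ℂ} (hz : z ∈ D) {a b : ℂ} (h : phi f z = spinorVec a b) (hr : spinorLen a b ≠ 0)
    (hconf : ∀ w ∈ D, ∑ k, phi f w k ^ 2 = 0) (hm : meanCurv f (unitNormal f) z = 0) :
    tension f z = 0 := by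
  set C : R3 := covDeriv f 1 (leftVel f 1) z + covDeriv f Complex.I (leftVel f Complex.I) z with hC
  have hCt : ∀ k, (C k : ℂ) = 4 * tension f z k := covDeriv_add_covDeriv hD hf hz
  have hφ := fun k => (contDiffOn_phi hD hf k).hasWirtingerAt hD hz
  have h1 : HasWirtingerAt (fun w => ∑ k, phi f w k ^ 2) _ _ z :=
    (((hφ 0).pow_two.add (hφ 1).pow_two).add (hφ 2).pow_two).congr_of_eventuallyEq
      (.of_forall fun w => Fin.sum_univ_three _)
  have h2 : HasWirtingerAt (fun w => ∑ k, phi f w k ^ 2) 0 0 z :=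
    (HasWirtingerAt.const 0).congr_of_eventuallyEq (by
      filter_upwards [hD.mem_nhds hz] with w hw using hconf w hw)
  have h3 := h1.dzbar_eq.symm.trans h2.dzbar_eq
  have h4 : ∑ k, phi f z k * (C k : ℂ) = 0 := by
    simp only [hCt, tension, nilConn, Fin.sum_univ_three, Matrix.cons_val]
    linear_combination 2 * h3
  have hN : C ⬝ᵥ unitNormal f z = 0 := by
    rw [meanCurv, ← hC, confFactor_eq h, div_eq_zero_iff] at hm
    refine hm.resolve_right ?_
    positivity
  have hre := congrArg Complex.re h4
  have him := congrArg Complex.im h4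
  simp only [Fin.sum_univ_three, Complex.add_re, Complex.add_im, Complex.re_mul_ofReal,
    Complex.im_mul_ofReal, Complex.zero_re, Complex.zero_im] at hre him
  have hC0 : C = 0 := by
    refine Matrix.eq_zero_of_mulVec_eq_zero (orient_unitNormal_pos h hr).ne' ?_
    ext k
    fin_cases k
    · simp [Matrix.mulVec, dotProduct, Fin.sum_univ_three, leftVel_one_eq]
      linarith
    · simp [Matrix.mulVec, dotProduct, Fin.sum_univ_three, leftVel_I_eq]
      linarith
    · simp [Matrix.mulVec]
      rw [dotProduct_comm, hN]
  ext k
  have := hCt k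
  rw [hC0] at this
  simpa using this.symm

/-- `a, b` are positively oriented generating spinors of the minimal nowhere-vertical surface `f`
on `D`. Minimality is expressed by the harmonic map equation `∇_{∂z̄} f_z = 0`, and not being
vertical by `|a| ≠ |b|`. -/
structure IsMinimalSpinors (D : Set ℂ) (f : ℂ → R3) (a b : ℂ → ℂ) : Prop where
  contDiffOn : ContDiffOn ℝ ∞ f D
  contDiffOn_fst : ContDiffOn ℝ ∞ a D
  contDiffOn_snd : ContDiffOn ℝ ∞ b D
  phi_eq : ∀ z ∈ D, phi f z = spinorVec (a z) (b z)
  tension_eq : ∀ z ∈ D, tension f z = 0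
  normSq_sub_ne : ∀ z ∈ D, Complex.normSq (a z) - Complex.normSq (b z) ≠ 0

/-- Twice `|a|² - |b|²`: the support of the surface with positively oriented spinors `a, b`, as a
complex number. -/
def spinorSupport (a b : ℂ → ℂ) (z : ℂ) : ℂ := 2 * (a z * conj (a z) - b z * conj (b z))

/-- The spinor expression `(i/2) (a ∂b̄ - b̄ ∂a)` of the Abresch–Rosenberg differential of a minimal
surface. -/
def spinorHopf (a b : ℂ → ℂ) (z : ℂ) : ℂ :=
  Complex.I / 2 * (a z * conj (dzbar b z) - conj (b z) * dz a z)

theorem conj_spinorSupport (a b : ℂ → ℂ) (z : ℂ) :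
    conj (spinorSupport a b z) = spinorSupport a b z := by
  simp [spinorSupport, Complex.conj_ofNat, mul_comm]

theorem spinorSupport_eq (a b : ℂ → ℂ) (z : ℂ) :
    spinorSupport a b z = ((2 * (Complex.normSq (a z) - Complex.normSq (b z)) : ℝ) : ℂ) := by
  simp [spinorSupport, Complex.mul_conj]

namespace IsMinimalSpinors

variable {D : Set ℂ} {f : ℂ → R3} {a b : ℂ → ℂ} {z : ℂ}

theorem mono (h : IsMinimalSpinors D f a b) {V : Set ℂ} (hV : V ⊆ D) :
    IsMinimalSpinors V f a b :=
  ⟨h.contDiffOn.mono hV, h.contDiffOn_fst.mono hV, h.contDiffOn_snd.mono hV,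
    fun z hz => h.phi_eq z (hV hz), fun z hz => h.tension_eq z (hV hz),
    fun z hz => h.normSq_sub_ne z (hV hz)⟩

variable (h : IsMinimalSpinors D f a b) (hD : IsOpen D) (hz : z ∈ D)
include h hz

theorem spinorSupport_ne : spinorSupport a b z ≠ 0 := by
  rw [spinorSupport_eq, Complex.ofReal_ne_zero]
  exact mul_ne_zero two_ne_zero (h.normSq_sub_ne z hz)

theorem support_eq : (support f (unitNormal f) z : ℂ) = spinorSupport a b z := by
  rw [_root_.support_eq (h.phi_eq z hz), spinorSupport_eq]

include hD

theorem hasWirtingerAt_phi_zero : HasWirtingerAt (fun w => phi f w 0)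
    (2 * conj (b z) * conj (dzbar b z) - 2 * a z * dz a z)
    (2 * conj (b z) * conj (dz b z) - 2 * a z * dzbar a z) z := by
  have ha := h.contDiffOn_fst.hasWirtingerAt hD hz
  have hb := (h.contDiffOn_snd.hasWirtingerAt hD hz).star
  refine (hb.pow_two.sub ha.pow_two).congr_of_eventuallyEq ?_
  filter_upwards [hD.mem_nhds hz] with w hw
  rw [h.phi_eq w hw]
  rfl

theorem hasWirtingerAt_phi_one : HasWirtingerAt (fun w => phi f w 1)
    (Complex.I * (2 * conj (b z) * conj (dzbar b z) + 2 * a z * dz a z))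
    (Complex.I * (2 * conj (b z) * conj (dz b z) + 2 * a z * dzbar a z)) z := by
  have ha := h.contDiffOn_fst.hasWirtingerAt hD hz
  have hb := (h.contDiffOn_snd.hasWirtingerAt hD hz).star
  refine ((hb.pow_two.add ha.pow_two).const_mul Complex.I).congr_of_eventuallyEq ?_
  filter_upwards [hD.mem_nhds hz] with w hw
  rw [h.phi_eq w hw]
  rfl

theorem hasWirtingerAt_phi_two : HasWirtingerAt (fun w => phi f w 2)
    (2 * (a z * conj (dzbar b z) + dz a z * conj (b z)))
    (2 * (a z * conj (dz b z) + dzbar a z * conj (b z))) z := by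
  have ha := h.contDiffOn_fst.hasWirtingerAt hD hz
  have hb := (h.contDiffOn_snd.hasWirtingerAt hD hz).star
  refine ((ha.mul hb).const_mul 2).congr_of_eventuallyEq ?_
  filter_upwards [hD.mem_nhds hz] with w hw
  rw [h.phi_eq w hw]
  simp [spinorVec, mul_assoc]

/-- The Dirac equations of a minimal surface, with potential `(i/4) h`. -/
theorem dirac : dzbar a z = Complex.I / 4 * spinorSupport a b z * b z ∧
    conj (dz b z) = Complex.I / 4 * spinorSupport a b z * conj (a z) := by
  have h0 := congrFun (h.tension_eq z hz) 0
  have h1 := congrFun (h.tension_eq z hz) 1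
  have h2 := congrFun (h.tension_eq z hz) 2
  rw [tension, (h.hasWirtingerAt_phi_zero hD hz).dzbar_eq] at h0
  rw [tension, (h.hasWirtingerAt_phi_one hD hz).dzbar_eq] at h1
  rw [tension, (h.hasWirtingerAt_phi_two hD hz).dzbar_eq] at h2
  simp only [h.phi_eq z hz, nilConn, spinorVec, Matrix.cons_val, map_sub, map_add, map_mul,
    map_pow, Complex.conj_conj, Complex.conj_I, Complex.conj_ofNat, Pi.zero_apply] at h0 h1 h2
  have hne := h.spinorSupport_ne hz
  simp only [spinorSupport] at hne ⊢
  generalize dzbar a z = α at *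
  generalize conj (dz b z) = β at *
  generalize a z = a at *
  generalize b z = b at *
  have e1 : a * (α - Complex.I / 4 * (2 * (a * conj a - b * conj b)) * b) = 0 := by
    linear_combination -(1 / 4) * (h0 + Complex.I * h1) +
      (1 / 2) * (conj b * β + a * α) * Complex.I_sq
  have e2 : conj b * (β - Complex.I / 4 * (2 * (a * conj a - b * conj b)) * conj a) = 0 := by
    linear_combination (1 / 4) * (h0 - Complex.I * h1) +
      (1 / 2) * (conj b * β + a * α) * Complex.I_sq
  have e3 : conj b * (α - Complex.I / 4 * (2 * (a * conj a - b * conj b)) * b) +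
      a * (β - Complex.I / 4 * (2 * (a * conj a - b * conj b)) * conj a) = 0 := by
    linear_combination (1 / 2) * h2
  by_cases ha : a = 0
  · have hb : conj b ≠ 0 := by
      rintro hb
      simp [ha, hb] at hne
    have e4 := (mul_eq_zero.mp e2).resolve_left hb
    rw [e4, mul_zero, add_zero] at e3
    exact ⟨sub_eq_zero.mp ((mul_eq_zero.mp e3).resolve_left hb), sub_eq_zero.mp e4⟩
  · have e4 := (mul_eq_zero.mp e1).resolve_left ha
    rw [e4, mul_zero, zero_add] at e3
    exact ⟨sub_eq_zero.mp e4, sub_eq_zero.mp ((mul_eq_zero.mp e3).resolve_left ha)⟩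

theorem hasWirtingerAt_fst :
    HasWirtingerAt a (dz a z) (Complex.I / 4 * spinorSupport a b z * b z) z :=
  (h.dirac hD hz).1 ▸ h.contDiffOn_fst.hasWirtingerAt hD hz

theorem hasWirtingerAt_snd :
    HasWirtingerAt b (-(Complex.I / 4) * spinorSupport a b z * a z) (dzbar b z) z := by
  refine (h.contDiffOn_snd.hasWirtingerAt hD hz).congr_coeff ?_ rfl
  have := congrArg conj (h.dirac hD hz).2
  rw [Complex.conj_conj] at this
  rw [this]
  simp [conj_spinorSupport, Complex.conj_ofNat]
  ring

theorem hasWirtingerAt_conj_snd : HasWirtingerAt (fun w => conj (b w)) (conj (dzbar b z))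
    (Complex.I / 4 * spinorSupport a b z * conj (a z)) z :=
  (h.dirac hD hz).2 ▸ (h.contDiffOn_snd.hasWirtingerAt hD hz).star

theorem hasWirtingerAt_spinorSupport : HasWirtingerAt (spinorSupport a b)
    (2 * (conj (a z) * dz a z - b z * conj (dzbar b z)))
    (conj (2 * (conj (a z) * dz a z - b z * conj (dzbar b z)))) z := by
  have ha := h.hasWirtingerAt_fst hD hz
  have hb := h.hasWirtingerAt_snd hD hz
  refine (((ha.mul ha.star).sub (hb.mul hb.star)).const_mul 2).congr_coeff ?_ ?_
  · simp only [map_mul, conj_spinorSupport, map_div₀, Complex.conj_I, Complex.conj_ofNat]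
    ring
  · simp only [map_mul, map_sub, map_neg, map_div₀, Complex.conj_I, Complex.conj_ofNat,
      Complex.conj_conj, conj_spinorSupport]
    ring

/-- The derivatives of the spinors not given by the Dirac equations, in terms of the support and
the Abresch–Rosenberg differential. -/
theorem spinorSupport_mul_dz_fst : spinorSupport a b z * dz a z =
    dz (spinorSupport a b) z * a z - 4 * Complex.I * spinorHopf a b z * b z := by
  rw [(h.hasWirtingerAt_spinorSupport hD hz).dz_eq, spinorSupport, spinorHopf]
  linear_combination 2 * (a z * conj (dzbar b z) - conj (b z) * dz a z) * b z * Complex.I_sq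

theorem spinorSupport_mul_conj_dzbar_snd : spinorSupport a b z * conj (dzbar b z) =
    dz (spinorSupport a b) z * conj (b z) - 4 * Complex.I * spinorHopf a b z * conj (a z) := by
  rw [(h.hasWirtingerAt_spinorSupport hD hz).dz_eq, spinorSupport, spinorHopf]
  linear_combination 2 * (a z * conj (dzbar b z) - conj (b z) * dz a z) * conj (a z) * Complex.I_sq

theorem abreschRosenberg_eq : abreschRosenberg f z = spinorHopf a b z := by
  have hr : (spinorLen (a z) (b z) : ℂ) ≠ 0 :=
    Complex.ofReal_ne_zero.mpr (spinorLen_pos (h.normSq_sub_ne z hz)).ne'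
  have hN : ∀ k, (unitNormal f z k : ℂ) =
      (spinorLen (a z) (b z) : ℂ)⁻¹ * (spinorNormal (a z) (b z) k : ℂ) := fun k => by
    simp [unitNormal_eq (h.phi_eq z hz)]
  have hI := Complex.I_sq
  rw [abreschRosenberg, meanCurv_eq_zero hD h.contDiffOn hz (h.tension_eq z hz)]
  simp only [Complex.ofReal_zero, mul_zero, zero_add, dotProduct, Fin.sum_univ_three, fzz,
    Pi.add_apply, hN, ofReal_spinorNormal, (h.hasWirtingerAt_phi_zero hD hz).dz_eq,
    (h.hasWirtingerAt_phi_one hD hz).dz_eq, (h.hasWirtingerAt_phi_two hD hz).dz_eq, nilConn,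
    h.phi_eq z hz, spinorVec, Matrix.cons_val, spinorHopf]
  have hI0 := Complex.I_ne_zero
  rw [ofReal_spinorLen] at hr ⊢
  generalize conj (dzbar b z) = q
  generalize dz a z = p
  generalize a z = a at *
  generalize b z = b at *
  have key : (2 * conj b * q - 2 * a * p + (Complex.I * (conj b ^ 2 + a ^ 2) * (2 * a * conj b) +
        2 * a * conj b * (Complex.I * (conj b ^ 2 + a ^ 2))) / 2) * (a * b + conj a * conj b) +
      (Complex.I * (2 * conj b * q + 2 * a * p) + -((conj b ^ 2 - a ^ 2) * (2 * a * conj b) +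
        2 * a * conj b * (conj b ^ 2 - a ^ 2)) / 2) *
          (-Complex.I * (a * b - conj a * conj b)) +
      (2 * (a * q + p * conj b)) * (a * conj a - b * conj b) =
      (a * conj a + b * conj b) * (2 * (a * q - conj b * p) + Complex.I * (2 * a * conj b) ^ 2) := by
    linear_combination -(2 * conj b * q + 2 * a * p) * (a * b - conj a * conj b) * hI
  have key' := eq_inv_mul_iff_mul_eq₀ hr |>.mpr key.symm
  generalize (a * conj a + b * conj b)⁻¹ = r at *
  rw [Complex.div_I]
  linear_combination -(Complex.I / 4) * key'

/-- The Abresch–Rosenberg differential of a minimal surface is holomorphic. -/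
theorem hasDerivAt_spinorHopf : ∃ B', HasDerivAt (spinorHopf a b) B' z := by
  have ha := h.hasWirtingerAt_fst hD hz
  have hb := h.hasWirtingerAt_conj_snd hD hz
  have hs := h.hasWirtingerAt_spinorSupport hD hz
  have hbc : ContDiffOn ℝ ∞ (fun w => conj (b w)) D :=
    Complex.conjCLE.contDiff.comp_contDiffOn h.contDiffOn_snd
  have ha2 := (h.contDiffOn_fst.dz hD).hasWirtingerAt hD hz
  have hb2 := (hbc.dz hD).hasWirtingerAt hD hz
  have e1 : dzbar (dz a) z = _ := (dzbar_dz h.contDiffOn_fst hD hz).trans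
    (HasWirtingerAt.dz_eq ((((hs.const_mul (Complex.I / 4)).mul
      (h.hasWirtingerAt_snd hD hz))).congr_of_eventuallyEq (by
        filter_upwards [hD.mem_nhds hz] with w hw using (h.dirac hD hw).1)))
  have e2 : dzbar (dz fun w => conj (b w)) z = _ := (dzbar_dz hbc hD hz).trans
    (HasWirtingerAt.dz_eq ((((hs.const_mul (Complex.I / 4)).mul ha.star)).congr_of_eventuallyEq (by
        filter_upwards [hD.mem_nhds hz] with w hw using
          (h.hasWirtingerAt_conj_snd hD hw).dzbar_eq)))
  have e3 : HasWirtingerAt (spinorHopf a b) _ _ z :=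
    (((ha.mul hb2).sub (hb.mul ha2)).const_mul (Complex.I / 2)).congr_of_eventuallyEq (by
      filter_upwards [hD.mem_nhds hz] with w hw
      rw [spinorHopf, (h.hasWirtingerAt_conj_snd hD hw).dz_eq])
  refine ⟨_, HasWirtingerAt.hasDerivAt (e3.congr_coeff rfl ?_)⟩
  rw [e1, e2, hb.dz_eq]
  simp only [spinorSupport, map_mul, map_sub, map_div₀, Complex.conj_I, Complex.conj_ofNat,
    Complex.conj_conj]
  ring

end IsMinimalSpinors

/-! ### Branches of the square root -/

theorem IsSqrtBranch.differentiableOn {V : Set ℂ} (hV : IsOpen V) {B s : ℂ → ℂ}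
    (hs : IsSqrtBranch V B s) (hB : DifferentiableOn ℂ B V) : DifferentiableOn ℂ s V := by
  intro z hz
  have hsz : s z ≠ 0 := fun h0 => (hs.2 z hz).1 (by simpa [h0] using (hs.2 z hz).2)
  have hc : ContinuousAt (fun w => s w / s z) z :=
    (hs.1.continuousAt (hV.mem_nhds hz)).div_const _
  have hre : ∀ᶠ w in 𝓝 z, 0 < (s w / s z).re := by
    refine (Complex.continuous_re.continuousAt.comp hc).eventually (lt_mem_nhds ?_)
    simp [hsz]
  have hE : s =ᶠ[𝓝 z] fun w => s z * (B w / B z) ^ (2⁻¹ : ℂ) := by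
    filter_upwards [hre, hV.mem_nhds hz] with w hw hwV
    have : B w / B z = (s w / s z) ^ 2 := by
      rw [div_pow, (hs.2 w hwV).2, (hs.2 z hz).2, neg_div_neg_eq]
    rw [this, Complex.sq_cpow_two_inv hw]
    field_simp
  have hBz := (hB z hz).differentiableAt (hV.mem_nhds hz)
  refine (DifferentiableAt.congr_of_eventuallyEq ?_ hE).differentiableWithinAt
  refine (DifferentiableAt.cpow_const (hBz.div_const _) ?_).const_mul _
  simp [(hs.2 z hz).1]

/-- Locally, a branch of `√(-B)` exists. -/
theorem exists_isSqrtBranch {D : Set ℂ} (hD : IsOpen D) {B : ℂ → ℂ} (hB : ContinuousOn B D) {z : ℂ}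
    (hz : z ∈ D) (hBz : B z ≠ 0) :
    ∃ V ⊆ D, IsOpen V ∧ z ∈ V ∧ ∃ s, IsSqrtBranch V B s := by
  refine ⟨D ∩ (fun w => B w / B z) ⁻¹' Complex.slitPlane, Set.inter_subset_left,
    (hB.div_const _).isOpen_inter_preimage hD Complex.isOpen_slitPlane, ⟨hz, by simp [hBz]⟩,
    fun w => (-B z) ^ (2⁻¹ : ℂ) * (B w / B z) ^ (2⁻¹ : ℂ), ?_, ?_⟩
  · refine continuousOn_const.mul (ContinuousOn.cpow_const
      ((hB.div_const _).mono Set.inter_subset_left) fun w hw => hw.2)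
  · rintro w ⟨-, hw⟩
    have hw0 : B w ≠ 0 := fun h0 => Complex.slitPlane_ne_zero hw (by simp [h0])
    refine ⟨hw0, ?_⟩
    have h2 : ∀ x : ℂ, (x ^ (2⁻¹ : ℂ)) ^ 2 = x := fun x => by
      simpa using Complex.cpow_nat_inv_pow x two_ne_zero
    rw [mul_pow, h2, h2]
    field_simp

/-! ### The dual spinors -/

theorem spinorVec_dual (k a b : ℂ) : spinorVec (k * b) (-conj k * a) =
    fun j => -k ^ 2 * conj (spinorVec a b j) := by
  ext j
  fin_cases j
  · simp [spinorVec]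
    ring
  · simp [spinorVec]
    ring
  · simp [spinorVec, Complex.conj_ofNat]
    ring

theorem spinorNormal_dual (k a b : ℂ) :
    spinorNormal (k * b) (-conj k * a) = (-Complex.normSq k) • spinorNormal a b := by
  have h : k * b * (-conj k * a) = ((-Complex.normSq k : ℝ) : ℂ) * (a * b) := by
    rw [Complex.ofReal_neg, ← Complex.mul_conj]
    ring
  ext j
  fin_cases j
  · simp only [spinorNormal, h, Complex.re_ofReal_mul]
    simp
    ring
  · simp only [spinorNormal, h, Complex.im_ofReal_mul]
    simp
    ring
  · simp [spinorNormal]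
    ring

theorem spinorLen_dual (k a b : ℂ) :
    spinorLen (k * b) (-conj k * a) = Complex.normSq k * spinorLen a b := by
  simp [spinorLen]
  ring

/-- The components of `(f*)⁻¹ f*_z = -(16 B / h²) conj (f⁻¹ f_z)`. Unlike the dual spinors, this
does not involve a branch of `√(-B)`. -/
def dualPhi (f N : ℂ → R3) (z : ℂ) : Fin 3 → ℂ :=
  fun k => -16 * abreschRosenberg f z / (support f N z : ℂ) ^ 2 * conj (phi f z k)

theorem dualSpinor_eq (f N : ℂ → R3) (s a b : ℂ → ℂ) (z : ℂ) :
    dualSpinor₁ f N s b z = 4 * s z / (support f N z : ℂ) * b z ∧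
    dualSpinor₂ f N s a z = -conj (4 * s z / (support f N z : ℂ)) * a z := by
  refine ⟨rfl, ?_⟩
  simp [dualSpinor₂, Complex.conj_ofNat]
  ring

theorem sq_dualFactor {f N : ℂ → R3} {V : Set ℂ} {s : ℂ → ℂ}
    (hs : IsSqrtBranch V (abreschRosenberg f) s) {z : ℂ} (hz : z ∈ V) :
    (4 * s z / (support f N z : ℂ)) ^ 2 =
      -16 * abreschRosenberg f z / (support f N z : ℂ) ^ 2 := by
  rw [div_pow, mul_pow, (hs.2 z hz).2]
  ring

theorem spinorVec_dualSpinor {f N : ℂ → R3} {V : Set ℂ} {s : ℂ → ℂ}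
    (hs : IsSqrtBranch V (abreschRosenberg f) s) {z : ℂ} (hz : z ∈ V) (a b : ℂ → ℂ) :
    spinorVec (dualSpinor₁ f N s b z) (dualSpinor₂ f N s a z) =
      fun k => 16 * abreschRosenberg f z / (support f N z : ℂ) ^ 2 *
        conj (spinorVec (a z) (b z) k) := by
  rw [(dualSpinor_eq f N s a b z).1, (dualSpinor_eq f N s a b z).2, spinorVec_dual,
    sq_dualFactor hs hz]
  ext k
  ring

namespace IsMinimalSpinors

variable {D : Set ℂ} {f : ℂ → R3} {a b : ℂ → ℂ} {z : ℂ} (h : IsMinimalSpinors D f a b)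
  (hD : IsOpen D)
include h hD

theorem differentiableOn_abreschRosenberg : DifferentiableOn ℂ (abreschRosenberg f) D := by
  intro z hz
  obtain ⟨B', hB'⟩ := h.hasDerivAt_spinorHopf hD hz
  refine (hB'.differentiableAt.congr_of_eventuallyEq ?_).differentiableWithinAt
  filter_upwards [hD.mem_nhds hz] with w hw using h.abreschRosenberg_eq hD hw

theorem contDiffOn_abreschRosenberg : ContDiffOn ℝ ∞ (abreschRosenberg f) D :=
  ((h.differentiableOn_abreschRosenberg hD).contDiffOn (n := ∞) hD).restrict_scalars ℝ

omit hD in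
theorem contDiffOn_support : ContDiffOn ℝ ∞ (fun z => (support f (unitNormal f) z : ℂ)) D := by
  have h1 : ContDiffOn ℝ ∞ (spinorSupport a b) D :=
    contDiffOn_const.mul ((h.contDiffOn_fst.mul
      (Complex.conjCLE.contDiff.comp_contDiffOn h.contDiffOn_fst)).sub
      (h.contDiffOn_snd.mul (Complex.conjCLE.contDiff.comp_contDiffOn h.contDiffOn_snd)))
  exact h1.congr fun z hz => h.support_eq hz

theorem contDiffOn_dualPhi (k : Fin 3) :
    ContDiffOn ℝ ∞ (fun z => dualPhi f (unitNormal f) z k) D := by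
  simp only [dualPhi, div_eq_mul_inv]
  refine ContDiffOn.mul ((contDiffOn_const.mul (h.contDiffOn_abreschRosenberg hD)).mul
    ((h.contDiffOn_support.pow 2).inv fun z hz => ?_))
    (Complex.conjCLE.contDiff.comp_contDiffOn (contDiffOn_phi hD h.contDiffOn k))
  rw [h.support_eq hz]
  exact pow_ne_zero 2 (h.spinorSupport_ne hz)

/-- `dualPhi` satisfies the harmonic map equation, hence also its real part, the Maurer–Cartan
equation. -/
theorem dzbar_dualPhi (hz : z ∈ D) (k : Fin 3) :
    dzbar (fun w => dualPhi f (unitNormal f) w k) z =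
      -nilConn (fun j => conj (dualPhi f (unitNormal f) z j)) (dualPhi f (unitNormal f) z) k := by
  have hne := h.spinorSupport_ne hz
  obtain ⟨B', hB'⟩ := h.hasDerivAt_spinorHopf hD hz
  have hs := h.hasWirtingerAt_spinorSupport hD hz
  have hc := conj_spinorSupport a b z
  have ep := h.spinorSupport_mul_dz_fst hD hz
  have eq := h.spinorSupport_mul_conj_dzbar_snd hD hz
  -- `m` is the part of the second derivative of `f` that carries the differential `B`.
  have main : ∀ k p q m, HasWirtingerAt (fun w => phi f w k) p q z →
      spinorSupport a b z * p = 2 * dz (spinorSupport a b) z * phi f z k -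
        8 * Complex.I * spinorHopf a b z * m →
      2 * nilConn (phi f z) (fun j => conj (phi f z j)) k =
        Complex.I * spinorSupport a b z * conj m →
      dzbar (fun w => dualPhi f (unitNormal f) w k) z =
        -nilConn (fun j => conj (dualPhi f (unitNormal f) z j))
          (dualPhi f (unitNormal f) z) k := by
    intro k p q m hφ hp hm
    have hF : HasWirtingerAt (fun w => dualPhi f (unitNormal f) w k) _ _ z :=
      (((hB'.hasWirtingerAt.const_mul (-16)).div hs.pow_two (pow_ne_zero 2 hne)).mul
        hφ.star).congr_of_eventuallyEq (by
          filter_upwards [hD.mem_nhds hz] with w hw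
          rw [dualPhi, h.abreschRosenberg_eq hD hw, h.support_eq hw])
    have hn : nilConn (fun j => conj (dualPhi f (unitNormal f) z j))
        (dualPhi f (unitNormal f) z) k =
        256 * spinorHopf a b z * conj (spinorHopf a b z) / spinorSupport a b z ^ 4 *
          nilConn (phi f z) (fun j => conj (phi f z j)) k := by
      have hd : ∀ j, conj (dualPhi f (unitNormal f) z j) = -16 * conj (spinorHopf a b z) /
          spinorSupport a b z ^ 2 * phi f z j := fun j => by
        simp [dualPhi, h.abreschRosenberg_eq hD hz, h.support_eq hz, hc, Complex.conj_ofNat]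
      have hd' : ∀ j, dualPhi f (unitNormal f) z j = -16 * spinorHopf a b z /
          spinorSupport a b z ^ 2 * conj (phi f z j) := fun j => by
        rw [dualPhi, h.abreschRosenberg_eq hD hz, h.support_eq hz]
      fin_cases k
      · simp only [nilConn, hd]
        simp only [hd', Fin.zero_eta, Matrix.cons_val]
        field_simp
        ring
      · simp only [nilConn, hd]
        simp only [hd', Fin.mk_one, Matrix.cons_val]
        field_simp
        ring
      · simp only [nilConn, hd]
        simp only [hd', Fin.reduceFinMk, Matrix.cons_val]
        field_simp
        ring
    have hp' := congrArg conj hp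
    simp only [map_mul, map_sub, hc, Complex.conj_I, Complex.conj_ofNat] at hp'
    rw [hF.dzbar_eq, hn, ← hs.dz_eq]
    field_simp
    linear_combination (-16 * spinorSupport a b z * spinorHopf a b z) * hp' +
      128 * spinorHopf a b z * conj (spinorHopf a b z) * hm
  fin_cases k
  · refine main _ _ _ (conj (a z) * conj (b z) - a z * b z) (h.hasWirtingerAt_phi_zero hD hz) ?_ ?_
    · simp only [h.phi_eq z hz, spinorVec, Fin.zero_eta, Matrix.cons_val]
      linear_combination 2 * conj (b z) * eq - 2 * a z * ep
    · simp only [h.phi_eq z hz, spinorVec, nilConn, Fin.zero_eta, Matrix.cons_val, spinorSupport,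
        map_sub, map_mul, map_add, map_pow, Complex.conj_conj, Complex.conj_I, Complex.conj_ofNat]
      ring
  · refine main _ _ _ (Complex.I * (conj (a z) * conj (b z) + a z * b z))
      (h.hasWirtingerAt_phi_one hD hz) ?_ ?_
    · simp only [h.phi_eq z hz, spinorVec, Fin.mk_one, Matrix.cons_val]
      linear_combination Complex.I * (2 * conj (b z) * eq + 2 * a z * ep)
    · simp only [h.phi_eq z hz, spinorVec, nilConn, Fin.mk_one, Matrix.cons_val, spinorSupport,
        map_sub, map_mul, map_add, map_pow, Complex.conj_conj, Complex.conj_I, Complex.conj_ofNat]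
      ring_nf
      simp only [Complex.I_sq]
      ring
  · refine main _ _ _ (a z * conj (a z) + b z * conj (b z))
      (h.hasWirtingerAt_phi_two hD hz) ?_ ?_
    · simp only [h.phi_eq z hz, spinorVec, Fin.reduceFinMk, Matrix.cons_val]
      linear_combination 2 * a z * eq + 2 * conj (b z) * ep
    · simp only [h.phi_eq z hz, spinorVec, nilConn, Fin.reduceFinMk, Matrix.cons_val,
        spinorSupport,
        map_sub, map_mul, map_add, map_pow, Complex.conj_conj, Complex.conj_I, Complex.conj_ofNat]
      ring

end IsMinimalSpinors

/-! ### Integration of the Maurer–Cartan form -/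

/-- On a simply connected domain, the Maurer–Cartan form given by `φ` can be integrated if `φ`
satisfies the harmonic map equation. As `Nil₃` is nilpotent of step two, the two horizontal
coordinates come first, and the third is found from a form that depends on them. -/
theorem exists_phi_eq {D : Set ℂ} (hD : IsOpen D) [SimplyConnectedSpace D] {φ : ℂ → Fin 3 → ℂ}
    (hφ : ∀ k, ContDiffOn ℝ ∞ (fun z => φ z k) D)
    (hMC : ∀ z ∈ D, ∀ k, dzbar (fun w => φ w k) z = -nilConn (fun j => conj (φ z j)) (φ z) k) :
    ∃ F : ℂ → R3, ContDiffOn ℝ ∞ F D ∧ ∀ z ∈ D, phi F z = φ z := by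
  obtain ⟨x, hx, hdx⟩ := exists_hasWirtingerAt_ofReal hD (hφ 0) (fun z hz => by
    rw [hMC z hz]
    simp only [nilConn, Matrix.cons_val, map_neg, map_div₀, map_add, map_mul, Complex.conj_conj,
      Complex.conj_ofNat]
    ring)
  obtain ⟨y, hy, hdy⟩ := exists_hasWirtingerAt_ofReal hD (hφ 1) (fun z hz => by
    rw [hMC z hz]
    simp only [nilConn, Matrix.cons_val, map_neg, map_div₀, map_add, map_mul, Complex.conj_conj,
      Complex.conj_ofNat]
    ring)
  have hX : ContDiffOn ℝ ∞ (fun w => (x w : ℂ)) D := Complex.ofRealCLM.contDiff.comp_contDiffOn hx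
  have hY : ContDiffOn ℝ ∞ (fun w => (y w : ℂ)) D := Complex.ofRealCLM.contDiff.comp_contDiffOn hy
  have hθ : ContDiffOn ℝ ∞ (fun w => φ w 2 - (1 / 2) * ((y w : ℂ) * φ w 0 - (x w : ℂ) * φ w 1)) D :=
    (hφ 2).sub (contDiffOn_const.mul ((hY.mul (hφ 0)).sub (hX.mul (hφ 1))))
  obtain ⟨t, ht, hdt⟩ := exists_hasWirtingerAt_ofReal hD hθ (fun z hz => by
    have hW := fun k => (hφ k).hasWirtingerAt hD hz
    have := (hW 2).sub ((((hdy z hz).mul (hW 0)).sub ((hdx z hz).mul (hW 1))).const_mul (1 / 2))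
    rw [this.dzbar_eq, hMC z hz, hMC z hz, hMC z hz]
    simp only [nilConn, Matrix.cons_val, map_neg, map_div₀, map_add, map_sub, map_mul,
      Complex.conj_conj, Complex.conj_ofNat, Complex.conj_ofReal, map_one]
    ring)
  have hF : ContDiffOn ℝ ∞ (fun w => (![x w, y w, t w] : R3)) D := by
    rw [contDiffOn_pi]
    intro k
    fin_cases k
    · exact hx
    · exact hy
    · exact ht
  refine ⟨fun w => ![x w, y w, t w], hF, fun z hz => ?_⟩
  have hd := hF.differentiableAt_of_isOpen hD hz
  ext k
  fin_cases k
  · exact (phi_zero hd).trans (hdx z hz).dz_eq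
  · exact (phi_one hd).trans (hdy z hz).dz_eq
  · refine (phi_two hd).trans ?_
    have e0 : dz (fun w => ((![x w, y w, t w] : R3) 0 : ℂ)) z = _ := (hdx z hz).dz_eq
    have e1 : dz (fun w => ((![x w, y w, t w] : R3) 1 : ℂ)) z = _ := (hdy z hz).dz_eq
    have e2 : dz (fun w => ((![x w, y w, t w] : R3) 2 : ℂ)) z = _ := (hdt z hz).dz_eq
    rw [e0, e1, e2]
    simp only [Matrix.cons_val, Fin.reduceFinMk]
    ring

theorem HasWirtingerAt.hasFDerivAt_zero {x : ℂ → ℝ} {p q z : ℂ}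
    (h : HasWirtingerAt (fun w => (x w : ℂ)) p q z) (hp : p = 0) :
    HasFDerivAt x (0 : ℂ →L[ℝ] ℝ) z := by
  have hx : DifferentiableAt ℝ x z := Complex.reCLM.differentiableAt.comp z h.differentiableAt
  have h1 := hx.hasWirtingerAt_ofReal
  rw [h.dz_eq, hp, hasWirtingerAt_ofReal_iff] at h1
  refine h1.congr_fderiv ?_
  ext
  simp

/-- Two surfaces with the same Maurer–Cartan form differ locally by a left translation. -/
theorem hasFDerivAt_nilMul_neg {F G : ℂ → R3} {z : ℂ} (hF : DifferentiableAt ℝ F z)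
    (hG : DifferentiableAt ℝ G z) (h : phi F z = phi G z) :
    HasFDerivAt (fun w => nilMul (F w) (-G w)) (0 : ℂ →L[ℝ] R3) z := by
  have hF' := fun k => (differentiableAt_pi.mp hF k).hasWirtingerAt_ofReal
  have hG' := fun k => (differentiableAt_pi.mp hG k).hasWirtingerAt_ofReal
  have h0 := congrFun h 0
  have h1 := congrFun h 1
  have h2 := congrFun h 2
  rw [phi_zero hF, phi_zero hG] at h0
  rw [phi_one hF, phi_one hG] at h1
  rw [phi_two hF, phi_two hG] at h2
  have d0 := ((hF' 0).sub (hG' 0))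
  have d1 := ((hF' 1).sub (hG' 1))
  have d2 := ((hF' 2).sub (hG' 2)).add
    ((((hG' 0).mul (hF' 1)).sub ((hF' 0).mul (hG' 1))).const_mul (1 / 2))
  rw [hasFDerivAt_pi']
  intro k
  fin_cases k
  · exact (HasWirtingerAt.hasFDerivAt_zero (x := fun w => F w 0 + -G w 0)
      (d0.congr_of_eventuallyEq (.of_forall fun w => by push_cast; ring)) (by rw [h0, sub_self]))
  · exact (HasWirtingerAt.hasFDerivAt_zero (x := fun w => F w 1 + -G w 1)
      (d1.congr_of_eventuallyEq (.of_forall fun w => by push_cast; ring)) (by rw [h1, sub_self]))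
  · refine (HasWirtingerAt.hasFDerivAt_zero
      (x := fun w => F w 2 + -G w 2 + (1 / 2) * (F w 0 * -G w 1 - -G w 0 * F w 1))
      (d2.congr_of_eventuallyEq (.of_forall fun w => by push_cast; ring)) ?_)
    rw [h0, h1] at *
    linear_combination h2

theorem nilMul_neg_eq_iff {p q r : R3} : nilMul p (-q) = r ↔ p = nilMul r q := by
  constructor
  · rintro rfl
    rw [nilMul_assoc, neg_nilMul, nilMul_zero]
  · rintro rfl
    have := neg_nilMul (-q)
    rw [neg_neg] at this
    rw [nilMul_assoc, this, nilMul_zero]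

/-! ### Functions that are locally constant off a discrete set -/

theorem isPreconnected_ball_diff_singleton (c : ℂ) {r : ℝ} (hr : 0 < r) :
    IsPreconnected (Metric.ball c r \ {c}) := by
  -- A punctured disc is the image of a half-plane under the exponential map.
  have h : Metric.ball c r \ {c} = (fun w => c + Complex.exp w) '' {w | w.re < Real.log r} := by
    ext z
    constructor
    · rintro ⟨hz, hzc⟩
      have hz0 : z - c ≠ 0 := sub_ne_zero.mpr hzc
      refine ⟨Complex.log (z - c), ?_, by simp [Complex.exp_log hz0]⟩
      rw [Set.mem_ofPred_eq, Complex.log_re]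
      exact Real.log_lt_log (norm_pos_iff.mpr hz0) (mem_ball_iff_norm.mp hz)
    · rintro ⟨w, hw, rfl⟩
      refine ⟨?_, by simp [Complex.exp_ne_zero]⟩
      rw [mem_ball_iff_norm, add_sub_cancel_left, Complex.norm_exp]
      exact (Real.lt_log_iff_exp_lt hr).mp hw
  rw [h]
  refine (Convex.isPreconnected ?_).image _ (by fun_prop)
  exact convex_halfSpace_re_lt _

/-- A function on a connected open set that is constant on a punctured neighbourhood of each point
takes the same constant everywhere. -/
theorem IsPreconnected.exists_forall_eventually_eq {X Y : Type*} [TopologicalSpace X] [T1Space X]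
    [∀ x : X, (𝓝[≠] x).NeBot] {D : Set X} (hD : IsPreconnected D) {G : X → Y}
    (hG : ∀ z ∈ D, ∃ c, ∀ᶠ w in 𝓝[≠] z, G w = c) {z₀ : X} (hz₀ : z₀ ∈ D) {c : Y}
    (hc : ∀ᶠ w in 𝓝[≠] z₀, G w = c) : ∀ z ∈ D, ∀ᶠ w in 𝓝[≠] z, G w = c := by
  by_contra hcon
  simp only [not_forall] at hcon
  obtain ⟨z₁, hz₁, hne⟩ := hcon
  have hne' : ∀ᶠ w in 𝓝[≠] z₁, G w ≠ c := by
    obtain ⟨d, hd⟩ := hG z₁ hz₁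
    filter_upwards [hd] with w hw hwc
    exact hne (by filter_upwards [hd] with v hv using by rw [hv, ← hw, hwc])
  obtain ⟨z, hz, h1, h2⟩ := hD _ _ (isOpen_setOfPred_eventually_nhdsWithin (p := fun w => G w = c))
    (isOpen_setOfPred_eventually_nhdsWithin (p := fun w => G w ≠ c)) (by
    intro z hz
    obtain ⟨d, hd⟩ := hG z hz
    by_cases hdc : d = c
    · left
      filter_upwards [hd] with w hw using hw.trans hdc
    · right
      filter_upwards [hd] with w hw using fun h => hdc (hw.symm.trans h)) ⟨z₀, hz₀, hc⟩
    ⟨z₁, hz₁, hne'⟩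
  have h1' : ∀ᶠ w in 𝓝[≠] z, G w = c := h1
  have h2' : ∀ᶠ w in 𝓝[≠] z, G w ≠ c := h2
  obtain ⟨w, hw1, hw2⟩ := (h1'.and h2').exists
  exact hw2 hw1

/-! ### The linear system and the dual surface -/

theorem contDiffOn_conj {F : ℂ → ℂ} {D : Set ℂ} (hF : ContDiffOn ℝ ∞ F D) :
    ContDiffOn ℝ ∞ (fun z => conj (F z)) D :=
  Complex.conjCLE.contDiff.comp_contDiffOn hF

theorem norm_eq_of_sq_eq_neg {B s : ℂ} (h : s ^ 2 = -B) : (‖B‖ : ℂ) = s * conj s := by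
  rw [Complex.mul_conj, Complex.normSq_eq_norm_sq, ← norm_pow, h, norm_neg]

theorem orient_neg_of_phi_eq {f g N : ℂ → R3} {z a b c d : ℂ} (hN : N z = unitNormal f z)
    (hf : phi f z = spinorVec a b) (hg : phi g z = spinorVec c d) {t : ℝ} (ht : t < 0)
    (hn : spinorNormal c d = t • spinorNormal a b) (hr : spinorLen a b ≠ 0)
    (hr' : spinorLen c d ≠ 0) : orient g N z < 0 := by
  have h1 := (spinorLen_nonneg a b).lt_of_ne' hr
  have h2 := (spinorLen_nonneg c d).lt_of_ne' hr'
  rw [orient_eq hg, hN, unitNormal_eq hf, hn, smul_dotProduct, dotProduct_smul,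
    spinorNormal_dotProduct_self, smul_eq_mul, smul_eq_mul]
  have h3 : 0 < spinorLen c d * ((spinorLen a b)⁻¹ * spinorLen a b ^ 2) := by positivity
  nlinarith

namespace IsMinimalSpinors

variable {D V : Set ℂ} {f fs : ℂ → R3} {a b s : ℂ → ℂ} {z : ℂ}

theorem spinorLen_ne (h : IsMinimalSpinors D f a b) (hz : z ∈ D) :
    spinorLen (a z) (b z) ≠ 0 :=
  (spinorLen_pos (h.normSq_sub_ne z hz)).ne'

theorem isGeneratingSpinors (h : IsMinimalSpinors D f a b) :
    IsGeneratingSpinors D f (unitNormal f) a b :=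
  ⟨h.contDiffOn_fst, h.contDiffOn_snd, isUnitNormal_iff.mpr fun z hz =>
    ⟨unitNormal_dotProduct_self (h.phi_eq z hz) (h.spinorLen_ne hz),
      sum_phi_mul_unitNormal (h.phi_eq z hz)⟩,
    fun z hz => Or.inl ⟨orient_unitNormal_pos (h.phi_eq z hz) (h.spinorLen_ne hz), h.phi_eq z hz⟩⟩

end IsMinimalSpinors

theorem IsGeneratingSpinors.phi_eq {D : Set ℂ} {f : ℂ → R3} {a b : ℂ → ℂ}
    (h : IsGeneratingSpinors D f (unitNormal f) a b) {z : ℂ} (hz : z ∈ D) :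
    phi f z = spinorVec (a z) (b z) :=
  ((h.2.2.2 z hz).resolve_right fun h' => h'.1.not_ge (orient_unitNormal_nonneg f z)).2

namespace IsMinimalSpinors

variable {D V : Set ℂ} {f fs : ℂ → R3} {a b s : ℂ → ℂ} {z : ℂ}

theorem of_isGeneratingSpinors (h : IsMinimalSpinors D f a b) {a' b' : ℂ → ℂ}
    (h' : IsGeneratingSpinors D f (unitNormal f) a' b') : IsMinimalSpinors D f a' b' := by
  refine ⟨h.contDiffOn, h'.1, h'.2.1, fun z hz => h'.phi_eq hz, h.tension_eq, fun z hz => ?_⟩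
  have h1 := _root_.support_eq (h.phi_eq z hz)
  rw [_root_.support_eq (h'.phi_eq hz)] at h1
  have h2 := h.normSq_sub_ne z hz
  intro h0
  rw [h0] at h1
  exact h2 (by linarith)

variable (h : IsMinimalSpinors V f a b) (hV : IsOpen V)
  (hs : IsSqrtBranch V (abreschRosenberg f) s)
include h hs

theorem sq_branch (hV : IsOpen V) (hz : z ∈ V) : s z ^ 2 = -spinorHopf a b z := by
  rw [(hs.2 z hz).2, h.abreschRosenberg_eq hV hz]

omit h in
theorem branch_ne (hz : z ∈ V) : s z ≠ 0 := fun h0 =>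
  (hs.2 z hz).1 (by simpa [h0] using (hs.2 z hz).2)

include hV

theorem hasDerivAt_branch (hz : z ∈ V) : HasDerivAt s (deriv s z) z :=
  ((hs.differentiableOn hV (h.differentiableOn_abreschRosenberg hV) z hz).differentiableAt
    (hV.mem_nhds hz)).hasDerivAt

theorem contDiffOn_branch : ContDiffOn ℝ ∞ s V :=
  ((hs.differentiableOn hV (h.differentiableOn_abreschRosenberg hV)).contDiffOn (n := ∞)
    hV).restrict_scalars ℝ

theorem contDiffOn_dualSpinor₁ : ContDiffOn ℝ ∞ (dualSpinor₁ f (unitNormal f) s b) V := by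
  have h1 := (h.contDiffOn_support.inv fun z hz => by
    rw [h.support_eq hz]
    exact h.spinorSupport_ne hz)
  refine (((contDiffOn_const (c := 4)).mul (h.contDiffOn_branch hV hs)).mul h1).mul
    h.contDiffOn_snd

theorem contDiffOn_dualSpinor₂ : ContDiffOn ℝ ∞ (dualSpinor₂ f (unitNormal f) s a) V := by
  have h1 := (h.contDiffOn_support.inv fun z hz => by
    rw [h.support_eq hz]
    exact h.spinorSupport_ne hz)
  refine (((contDiffOn_const (c := 4)).mul (contDiffOn_conj
    (h.contDiffOn_branch hV hs)).neg).mul h1).mul h.contDiffOn_fst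

theorem hasWirtingerAt_dualSpinor₁ (hz : z ∈ V) :
    HasWirtingerAt (dualSpinor₁ f (unitNormal f) s b)
      (4 * deriv s z * b z / spinorSupport a b z -
        4 * s z * dz (spinorSupport a b) z * b z / spinorSupport a b z ^ 2 - Complex.I * s z * a z)
      (-16 * Complex.I * s z * conj (s z) ^ 2 * a z / spinorSupport a b z ^ 2) z := by
  have hne := h.spinorSupport_ne hz
  have hS := h.hasWirtingerAt_spinorSupport hV hz
  have h1 : HasWirtingerAt (dualSpinor₁ f (unitNormal f) s b) _ _ z :=
    ((((h.hasDerivAt_branch hV hs hz).hasWirtingerAt.const_mul 4).div hS hne).mul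
      (h.hasWirtingerAt_snd hV hz)).congr_of_eventuallyEq (by
        filter_upwards [hV.mem_nhds hz] with w hw
        rw [dualSpinor₁, h.support_eq hw])
  have e := congrArg conj (h.spinorSupport_mul_conj_dzbar_snd hV hz)
  have hsq := congrArg conj (h.sq_branch hs hV hz)
  simp only [map_mul, map_sub, map_neg, map_pow, conj_spinorSupport, Complex.conj_conj,
    Complex.conj_I, Complex.conj_ofNat] at e hsq
  refine h1.congr_coeff ?_ ?_
  · rw [← hS.dz_eq]
    field_simp
    ring
  · rw [← hS.dz_eq]
    field_simp
    linear_combination 4 * s z * e + 16 * s z * Complex.I * a z * hsq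

theorem hasWirtingerAt_dualSpinor₂ (hz : z ∈ V) :
    HasWirtingerAt (dualSpinor₂ f (unitNormal f) s a)
      (-16 * Complex.I * conj (s z) * s z ^ 2 * b z / spinorSupport a b z ^ 2)
      (-4 * conj (deriv s z) * a z / spinorSupport a b z +
        4 * conj (s z) * conj (dz (spinorSupport a b) z) * a z / spinorSupport a b z ^ 2 -
          Complex.I * conj (s z) * b z) z := by
  have hne := h.spinorSupport_ne hz
  have hS := h.hasWirtingerAt_spinorSupport hV hz
  have h1 : HasWirtingerAt (dualSpinor₂ f (unitNormal f) s a) _ _ z :=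
    ((((h.hasDerivAt_branch hV hs hz).hasWirtingerAt.star.neg.const_mul 4).div hS hne).mul
      (h.hasWirtingerAt_fst hV hz)).congr_of_eventuallyEq (by
        filter_upwards [hV.mem_nhds hz] with w hw
        rw [dualSpinor₂, h.support_eq hw])
  have e := h.spinorSupport_mul_dz_fst hV hz
  have hsq := h.sq_branch hs hV hz
  refine h1.congr_coeff ?_ ?_
  · rw [← hS.dz_eq, map_zero]
    field_simp
    linear_combination -4 * conj (s z) * e + 16 * conj (s z) * Complex.I * b z * hsq
  · rw [← hS.dz_eq]
    field_simp
    ring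

/-- The dual spinors solve the linear system whose potential `e^{w/2}` is `4 i |B| / h`. -/
theorem exists_linearSpinorSystem : ∃ w : ℂ → ℂ, ContDiffOn ℝ ∞ w V ∧
    (∀ z ∈ V, Complex.exp (w z / 2) =
      4 * Complex.I * (‖abreschRosenberg f z‖ : ℂ) / (support f (unitNormal f) z : ℂ)) ∧
    LinearSpinorSystem V (dualSpinor₁ f (unitNormal f) s b) (dualSpinor₂ f (unitNormal f) s a) w
      (abreschRosenberg f) := by
  set E : ℂ → ℂ := fun z => 4 * Complex.I * (s z * conj (s z)) / spinorSupport a b z with hE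
  have hEne : ∀ z ∈ V, E z ≠ 0 := fun z hz => by
    have := branch_ne hs hz
    have := h.spinorSupport_ne hz
    have := Complex.I_ne_zero
    simp [*]
  -- `E` is imaginary, so that it stays away from the cut of the logarithm.
  have hEslit : ∀ z ∈ V, E z ∈ Complex.slitPlane := fun z hz => by
    refine Complex.mem_slitPlane_iff.mpr (Or.inr fun h0 => hEne z hz (Complex.ext ?_ h0))
    have hc : conj (E z) = -E z := by
      simp [hE, conj_spinorSupport, Complex.conj_ofNat]
      ring
    have := congrArg Complex.re hc
    rw [Complex.conj_re, Complex.neg_re] at this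
    rw [Complex.zero_re]
    linarith
  have hEsm : ContDiffOn ℝ ∞ E V := by
    have h1 := h.contDiffOn_branch hV hs
    have h2 := h.contDiffOn_support.inv fun z hz => by
      rw [h.support_eq hz]
      exact h.spinorSupport_ne hz
    refine ((contDiffOn_const (c := 4 * Complex.I)).mul (h1.mul
      (contDiffOn_conj h1)) |>.mul h2).congr fun z hz => ?_
    simp only [Pi.inv_apply, h.support_eq hz, hE, div_eq_mul_inv]
  obtain ⟨w, hw⟩ : ∃ w : ℂ → ℂ, w = fun z => 2 * Complex.log (E z) := ⟨_, rfl⟩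
  have hwexp : ∀ z ∈ V, Complex.exp (w z / 2) = E z := fun z hz => by
    rw [hw, mul_div_cancel_left₀ _ two_ne_zero, Complex.exp_log (hEne z hz)]
  refine ⟨w, ?_, fun z hz => ?_, fun z hz => ?_⟩
  · rw [hw]
    refine contDiffOn_const.mul fun z hz => ?_
    exact ((Complex.contDiffAt_log (hEslit z hz)).restrict_scalars ℝ).comp_contDiffWithinAt z
      (hEsm z hz)
  · rw [hwexp z hz, norm_eq_of_sq_eq_neg (hs.2 z hz).2, h.support_eq hz]
  · have hne := h.spinorSupport_ne hz
    have hsz := branch_ne hs hz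
    have hsz' : conj (s z) ≠ 0 := (map_ne_zero _).mpr hsz
    have hI := Complex.I_ne_zero
    have hS := h.hasWirtingerAt_spinorSupport hV hz
    have hsd := (h.hasDerivAt_branch hV hs hz).hasWirtingerAt
    have hEd : HasWirtingerAt E _ _ z :=
      ((hsd.mul hsd.star).const_mul (4 * Complex.I)).div hS hne
    have hwd : HasWirtingerAt w _ _ z := hw ▸
      (HasWirtingerAt.comp_hasDerivAt (Complex.hasDerivAt_log (hEslit z hz)) hEd).const_mul 2
    have hneg : Complex.exp (-w z / 2) = (E z)⁻¹ := by
      rw [neg_div, Complex.exp_neg, hwexp z hz]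
    have hB : abreschRosenberg f z = -s z ^ 2 := by rw [(hs.2 z hz).2, neg_neg]
    have h1 := h.hasWirtingerAt_dualSpinor₁ hV hs hz
    have h2 := h.hasWirtingerAt_dualSpinor₂ hV hs hz
    rw [hwexp z hz, hneg, h1.dz_eq, h1.dzbar_eq, h2.dz_eq, h2.dzbar_eq, hwd.dz_eq,
      hwd.dzbar_eq, hB, ← hS.dz_eq]
    simp only [dualSpinor₁, dualSpinor₂, h.support_eq hz, hE, map_zero, mul_zero, zero_mul,
      zero_add, add_zero, map_neg, map_pow]
    have hI2 := Complex.I_sq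
    constructor
    · ext k
      fin_cases k
      · simp [Matrix.vecMul, dotProduct]
        field_simp
        linear_combination -(spinorSupport a b z ^ 2 * s z * a z) * hI2
      · simp [Matrix.vecMul, dotProduct]
        field_simp
        ring
    · ext k
      fin_cases k
      · simp [Matrix.vecMul, dotProduct]
        field_simp
        ring
      · simp [Matrix.vecMul, dotProduct]
        field_simp
        linear_combination -(spinorSupport a b z ^ 2 * conj (s z) * b z) * hI2

omit hs in
theorem tension_eq_zero_of_phi_eq (hphi : ∀ z ∈ V, phi fs z = dualPhi f (unitNormal f) z)
    (hz : z ∈ V) : tension fs z = 0 := by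
  ext k
  have hE : (fun w => phi fs w k) =ᶠ[𝓝 z] fun w => dualPhi f (unitNormal f) w k := by
    filter_upwards [hV.mem_nhds hz] with w hw
    rw [hphi w hw]
  have h1 := h.dzbar_dualPhi hV hz k
  rw [tension, dzbar, hE.fderiv_eq, ← dzbar, h1, hphi z hz]
  simp

omit hV in
theorem phi_eq_neg_spinorVec_iff (hz : z ∈ V) : phi fs z = dualPhi f (unitNormal f) z ↔
    phi fs z = -spinorVec (dualSpinor₁ f (unitNormal f) s b z)
      (dualSpinor₂ f (unitNormal f) s a z) := by
  rw [spinorVec_dualSpinor hs hz, ← h.phi_eq z hz]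
  have : dualPhi f (unitNormal f) z = -fun k => 16 * abreschRosenberg f z /
      (support f (unitNormal f) z : ℂ) ^ 2 * conj (phi f z k) := by
    ext k
    simp [dualPhi]
    ring
  rw [this]

/-- Where `B ≠ 0`, the dual surface is again minimal, and its positively oriented spinors are
`i ψ₁*` and `-i ψ₂*`. -/
theorem dual (hfs : ContDiffOn ℝ ∞ fs V)
    (hphi : ∀ z ∈ V, phi fs z = dualPhi f (unitNormal f) z) :
    IsMinimalSpinors V fs (fun z => Complex.I * dualSpinor₁ f (unitNormal f) s b z)
      (fun z => -Complex.I * dualSpinor₂ f (unitNormal f) s a z) where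
  contDiffOn := hfs
  contDiffOn_fst := contDiffOn_const.mul (h.contDiffOn_dualSpinor₁ hV hs)
  contDiffOn_snd := contDiffOn_const.mul (h.contDiffOn_dualSpinor₂ hV hs)
  phi_eq z hz := by
    rw [(h.phi_eq_neg_spinorVec_iff hs hz).mp (hphi z hz), neg_spinorVec]
  tension_eq z hz := h.tension_eq_zero_of_phi_eq hV hphi hz
  normSq_sub_ne z hz := by
    have h1 := h.normSq_sub_ne z hz
    have h2 : Complex.normSq (s z) ≠ 0 := Complex.normSq_eq_zero.not.mpr (branch_ne hs hz)
    have h3 : support f (unitNormal f) z ≠ 0 := by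
      rw [_root_.support_eq (h.phi_eq z hz)]
      exact mul_ne_zero two_ne_zero h1
    rw [(dualSpinor_eq f (unitNormal f) s a b z).1, (dualSpinor_eq f (unitNormal f) s a b z).2]
    simp only [map_mul, map_div₀, Complex.normSq_neg, Complex.normSq_I,
      Complex.normSq_conj, Complex.normSq_ofReal, one_mul, ← mul_sub]
    refine mul_ne_zero (div_ne_zero (mul_ne_zero ?_ h2) (mul_ne_zero h3 h3)) ?_
    · simp
    · intro h0
      exact h1 (by linarith)

/-- The spinor differential does not change under duality. -/
theorem spinorHopf_dual (hz : z ∈ V) :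
    spinorHopf (fun z => Complex.I * dualSpinor₁ f (unitNormal f) s b z)
      (fun z => -Complex.I * dualSpinor₂ f (unitNormal f) s a z) z = spinorHopf a b z := by
  have hne := h.spinorSupport_ne hz
  have h1 := (h.hasWirtingerAt_dualSpinor₁ hV hs hz).const_mul Complex.I
  have h2 := (h.hasWirtingerAt_dualSpinor₂ hV hs hz).const_mul (-Complex.I)
  have hsq := h.sq_branch hs hV hz
  rw [spinorHopf, h1.dz_eq, h2.dzbar_eq]
  simp only [dualSpinor₁, dualSpinor₂, h.support_eq hz, map_mul, map_sub, map_add, map_neg,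
    map_div₀, map_pow, Complex.conj_I, Complex.conj_ofNat, Complex.conj_conj,
    conj_spinorSupport]
  field_simp
  have hS : spinorSupport a b z = 2 * (a z * conj (a z) - b z * conj (b z)) := rfl
  linear_combination 2 * Complex.I ^ 4 * s z ^ 2 * spinorSupport a b z ^ 2 * hS -
    2 * spinorSupport a b z ^ 3 * hsq -
    2 * spinorSupport a b z ^ 3 * s z ^ 2 * (Complex.I ^ 2 - 1) * Complex.I_sq

end IsMinimalSpinors

theorem IsSqrtBranch.congr {V : Set ℂ} {B B' s : ℂ → ℂ} (hs : IsSqrtBranch V B s)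
    (hB : ∀ z ∈ V, B' z = B z) : IsSqrtBranch V B' s :=
  ⟨hs.1, fun z hz => by rw [hB z hz]; exact hs.2 z hz⟩

theorem IsGeneratingSpinors.congr_normal {V : Set ℂ} {f N N' : ℂ → R3} {a b : ℂ → ℂ}
    (h : IsGeneratingSpinors V f N a b) (hN : ∀ z ∈ V, N' z = N z) :
    IsGeneratingSpinors V f N' a b := by
  refine ⟨h.1, h.2.1, fun z hz => ?_, fun z hz => ?_⟩
  · rw [hN z hz]
    exact h.2.2.1 z hz
  · rw [orient, hN z hz]
    exact h.2.2.2 z hz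

theorem normSq_dualFactor {f N : ℂ → R3} {V : Set ℂ} {s : ℂ → ℂ}
    (hs : IsSqrtBranch V (abreschRosenberg f) s) {z : ℂ} (hz : z ∈ V) :
    Complex.normSq (4 * s z / (support f N z : ℂ)) =
      16 * ‖abreschRosenberg f z‖ / support f N z ^ 2 := by
  have h1 : Complex.normSq (s z) = ‖abreschRosenberg f z‖ := by
    rw [Complex.normSq_eq_norm_sq, ← norm_pow, (hs.2 z hz).2, norm_neg]
  rw [map_div₀, map_mul, h1, Complex.normSq_ofReal, Complex.normSq_ofNat]
  ring

/-- Where the Maurer–Cartan form of `fs` is `dualPhi`, the conformal factor is that of the dual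
surface, also at the zeros of `B`. -/
theorem confFactor_of_phi_eq_dualPhi {f fs N : ℂ → R3} {z : ℂ} (h : phi fs z = dualPhi f N z) :
    confFactor fs z =
      4 ^ 4 * ‖abreschRosenberg f z‖ ^ 2 / support f N z ^ 4 * confFactor f z := by
  have h1 : ∀ k, ‖dualPhi f N z k‖ ^ 2 =
      4 ^ 4 * ‖abreschRosenberg f z‖ ^ 2 / support f N z ^ 4 * ‖phi f z k‖ ^ 2 := fun k => by
    simp only [dualPhi, norm_mul, norm_div, norm_neg, norm_pow, Complex.norm_real, RCLike.norm_conj,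
      mul_pow, div_pow, Complex.norm_ofNat, ← pow_mul, Real.norm_eq_abs]
    rw [show (2 * 2) = 4 by norm_num, Even.pow_abs (by decide)]
    ring
  simp only [confFactor, h, h1, ← Finset.mul_sum]
  ring

namespace IsMinimalSpinors

variable {D V : Set ℂ} {f fs g : ℂ → R3} {a b s : ℂ → ℂ} {z : ℂ}

theorem support_ne (h : IsMinimalSpinors D f a b) (hz : z ∈ D) :
    support f (unitNormal f) z ≠ 0 := by
  have := h.spinorSupport_ne hz
  rw [← h.support_eq hz] at this
  exact_mod_cast this

section Branch

variable (h : IsMinimalSpinors V f a b) (hs : IsSqrtBranch V (abreschRosenberg f) s)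
include h hs

theorem normSq_dualFactor_pos (hz : z ∈ V) :
    0 < Complex.normSq (4 * s z / (support f (unitNormal f) z : ℂ)) := by
  rw [normSq_dualFactor hs hz]
  have h1 := norm_pos_iff.mpr (hs.2 z hz).1
  have h2 := h.support_ne hz
  positivity

omit h hs in
theorem spinorLen_dualSpinor (f : ℂ → R3) (s a b : ℂ → ℂ) (z : ℂ) :
    spinorLen (dualSpinor₁ f (unitNormal f) s b z) (dualSpinor₂ f (unitNormal f) s a z) =
      Complex.normSq (4 * s z / (support f (unitNormal f) z : ℂ)) * spinorLen (a z) (b z) := by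
  rw [(dualSpinor_eq f (unitNormal f) s a b z).1, (dualSpinor_eq f (unitNormal f) s a b z).2,
    spinorLen_dual]

omit h hs in
theorem spinorNormal_dualSpinor (f : ℂ → R3) (s a b : ℂ → ℂ) (z : ℂ) :
    spinorNormal (dualSpinor₁ f (unitNormal f) s b z) (dualSpinor₂ f (unitNormal f) s a z) =
      (-Complex.normSq (4 * s z / (support f (unitNormal f) z : ℂ))) •
        spinorNormal (a z) (b z) := by
  rw [(dualSpinor_eq f (unitNormal f) s a b z).1, (dualSpinor_eq f (unitNormal f) s a b z).2,
    spinorNormal_dual]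

theorem spinorLen_dualSpinor_ne (hz : z ∈ V) :
    spinorLen (dualSpinor₁ f (unitNormal f) s b z) (dualSpinor₂ f (unitNormal f) s a z) ≠ 0 := by
  rw [spinorLen_dualSpinor]
  exact mul_ne_zero (h.normSq_dualFactor_pos hs hz).ne' (h.spinorLen_ne hz)

/-- The dual spinors generate every surface with Maurer–Cartan form `dualPhi`. -/
theorem isGeneratingSpinors_dual (hV : IsOpen V)
    (hphi : ∀ z ∈ V, phi fs z = dualPhi f (unitNormal f) z) :
    IsGeneratingSpinors V fs (unitNormal f) (dualSpinor₁ f (unitNormal f) s b)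
      (dualSpinor₂ f (unitNormal f) s a) := by
  refine ⟨h.contDiffOn_dualSpinor₁ hV hs, h.contDiffOn_dualSpinor₂ hV hs,
    isUnitNormal_iff.mpr fun z hz => ⟨unitNormal_dotProduct_self (h.phi_eq z hz)
      (h.spinorLen_ne hz), ?_⟩, fun z hz => Or.inr ?_⟩
  · have h1 := congrArg conj (sum_phi_mul_unitNormal (h.phi_eq z hz))
    simp only [hphi z hz, dualPhi, mul_assoc, ← Finset.mul_sum]
    simp only [map_sum, map_mul, Complex.conj_ofReal, map_zero] at h1
    rw [h1, mul_zero]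
  · have hd := (h.phi_eq_neg_spinorVec_iff hs hz).mp (hphi z hz)
    refine ⟨orient_neg_of_phi_eq rfl (h.phi_eq z hz) (hd.trans (neg_spinorVec _ _))
      (neg_lt_zero.mpr (h.normSq_dualFactor_pos hs hz)) ?_ (h.spinorLen_ne hz) ?_, hd⟩
    · rw [spinorNormal_I_mul, spinorNormal_dualSpinor]
    · rw [spinorLen_I_mul]
      exact h.spinorLen_dualSpinor_ne hs hz

/-- If the dual spinors generate `fs`, the sign in the definition of generating spinors is
negative, as the dual spinors define the normal direction opposite to that of `f`. -/
theorem phi_eq_dualPhi_of_isGeneratingSpinors (hz : z ∈ V)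
    (hfs : IsGeneratingSpinors V fs (unitNormal f) (dualSpinor₁ f (unitNormal f) s b)
      (dualSpinor₂ f (unitNormal f) s a)) : phi fs z = dualPhi f (unitNormal f) z := by
  rw [h.phi_eq_neg_spinorVec_iff hs hz]
  refine ((hfs.2.2.2 z hz).resolve_left fun ⟨ho, hp⟩ => ho.not_gt ?_).2
  exact orient_neg_of_phi_eq rfl (h.phi_eq z hz) hp
    (neg_lt_zero.mpr (h.normSq_dualFactor_pos hs hz)) (spinorNormal_dualSpinor f s a b z)
    (h.spinorLen_ne hz) (h.spinorLen_dualSpinor_ne hs hz)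

theorem unitNormal_dual (hV : IsOpen V) (hfs : ContDiffOn ℝ ∞ fs V)
    (hphi : ∀ z ∈ V, phi fs z = dualPhi f (unitNormal f) z) (hz : z ∈ V) :
    unitNormal fs z = -unitNormal f z := by
  have hk := (h.normSq_dualFactor_pos hs hz).ne'
  rw [unitNormal_eq ((h.dual hV hs hfs hphi).phi_eq z hz), unitNormal_eq (h.phi_eq z hz),
    spinorNormal_I_mul, spinorLen_I_mul, spinorNormal_dualSpinor, spinorLen_dualSpinor,
    smul_smul, ← neg_smul]
  congr 1
  have := h.spinorLen_ne hz
  generalize Complex.normSq (4 * s z / (support f (unitNormal f) z : ℂ)) = t at hk ⊢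
  field_simp

end Branch

/-- A dual surface is a smooth map with Maurer–Cartan form `dualPhi` off the zeros of `B`. -/
theorem isDualSurface_iff (h : IsMinimalSpinors D f a b) (hD : IsOpen D) :
    IsDualSurface D f (unitNormal f) fs ↔ ContDiffOn ℝ ∞ fs D ∧
      ∀ z ∈ D, abreschRosenberg f z ≠ 0 → phi fs z = dualPhi f (unitNormal f) z := by
  refine and_congr_right fun hfs => ⟨fun hdual z hz hB => ?_, fun hphi V hVD hV a' b' s hab hs => ?_⟩
  · obtain ⟨V, hVD, hV, hzV, s, hs⟩ := exists_isSqrtBranch hD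
      (h.differentiableOn_abreschRosenberg hD).continuousOn hz hB
    exact (h.mono hVD).phi_eq_dualPhi_of_isGeneratingSpinors hs hzV
      (hdual V hVD hV a b s (h.mono hVD).isGeneratingSpinors hs)
  · exact ((h.mono hVD).of_isGeneratingSpinors hab).isGeneratingSpinors_dual hs hV
      fun z hz => hphi z (hVD hz) (hs.2 z hz).1

section Dual

variable (h : IsMinimalSpinors D f a b) (hD : IsOpen D)
  (hB : ∀ z ∈ D, abreschRosenberg f z ≠ 0) (hfs : ContDiffOn ℝ ∞ fs D)
  (hphi : ∀ z ∈ D, phi fs z = dualPhi f (unitNormal f) z)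
include h hD hB hfs hphi

/-- The invariants of the dual surface, away from the zeros of `B`. -/
theorem dual_invariants (hz : z ∈ D) :
    (-unitNormal fs) z = unitNormal f z ∧ support fs (-unitNormal fs) z =
      4 ^ 2 * ‖abreschRosenberg f z‖ / support f (unitNormal f) z ∧
    abreschRosenberg fs z = abreschRosenberg f z := by
  obtain ⟨V, hVD, hV, hzV, s, hs⟩ := exists_isSqrtBranch hD
    (h.differentiableOn_abreschRosenberg hD).continuousOn hz (hB z hz)
  have hm := h.mono hVD
  have hphi' := fun z hz => hphi z (hVD hz)
  have hd := hm.dual hV hs (hfs.mono hVD) hphi'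
  have hN : (-unitNormal fs) z = unitNormal f z := by
    rw [Pi.neg_apply, hm.unitNormal_dual hs hV (hfs.mono hVD) hphi' hzV, neg_neg]
  refine ⟨hN, ?_, ?_⟩
  · have h1 : support fs (-unitNormal fs) z =
        Complex.normSq (4 * s z / (support f (unitNormal f) z : ℂ)) *
          support f (unitNormal f) z := by
      rw [support, hN, sqrt_confFactor (hd.phi_eq z hzV), spinorLen_I_mul,
        spinorLen_dualSpinor, support, sqrt_confFactor (hm.phi_eq z hzV)]
      ring
    have := h.support_ne hz
    rw [h1, normSq_dualFactor hs hzV]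
    field_simp
    ring
  · rw [hd.abreschRosenberg_eq hV hzV, hm.spinorHopf_dual hV hs hzV,
      hm.abreschRosenberg_eq hV hzV]

/-- Applying the duality of spinors twice gives the Maurer–Cartan form of `f` again. -/
theorem spinorVec_dual_dual (hz : z ∈ D) (hVz : z ∈ V)
    (hs : IsSqrtBranch V (abreschRosenberg fs) s) {c d : ℂ → ℂ}
    (hcd : phi fs z = -spinorVec (c z) (d z)) :
    spinorVec (dualSpinor₁ fs (-unitNormal fs) s d z) (dualSpinor₂ fs (-unitNormal fs) s c z) =
      phi f z := by
  obtain ⟨-, hsupp, hAR⟩ := h.dual_invariants hD hB hfs hphi hz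
  have h1 : spinorVec (c z) (d z) = -phi fs z := by rw [hcd, neg_neg]
  have hn : (‖abreschRosenberg f z‖ : ℂ) ^ 2 =
      abreschRosenberg f z * conj (abreschRosenberg f z) := (Complex.mul_conj' _).symm
  have hne : (support f (unitNormal f) z : ℂ) ≠ 0 := by exact_mod_cast h.support_ne hz
  have hn0 : (‖abreschRosenberg f z‖ : ℂ) ≠ 0 := by
    exact_mod_cast (norm_pos_iff.mpr (hB z hz)).ne'
  rw [spinorVec_dualSpinor hs hVz, h1, hsupp, hAR, hphi z hz]
  ext k
  simp only [Pi.neg_apply, dualPhi, map_neg, map_mul, map_div₀, map_pow, Complex.conj_conj,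
    Complex.conj_ofReal, Complex.conj_ofNat]
  push_cast
  field_simp
  linear_combination -256 * phi f z k * hn

/-- Where `B ≠ 0`, the dual surfaces of the dual surface `fs` are the maps with the
Maurer–Cartan form of `f`. -/
theorem isDualSurface_dual_iff : IsDualSurface D fs (-unitNormal fs) g ↔
    ContDiffOn ℝ ∞ g D ∧ ∀ z ∈ D, phi g z = phi f z := by
  have hinv := fun z hz => h.dual_invariants hD hB hfs hphi (z := z) hz
  -- The sign of the orientation decides between the two cases of a generating pair for `fs`.
  have hneg : ∀ {V : Set ℂ} (_ : V ⊆ D) {c d : ℂ → ℂ},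
      IsGeneratingSpinors V fs (-unitNormal fs) c d → ∀ z ∈ V,
        phi fs z = -spinorVec (c z) (d z) := by
    intro V hVD c d hcd z hz
    refine ((hcd.2.2.2 z hz).resolve_left fun ⟨ho, _⟩ => ?_).2
    have h1 := orient_unitNormal_nonneg fs z
    rw [orient_eq_dotProduct] at ho h1
    rw [Pi.neg_apply, dotProduct_neg] at ho
    linarith
  refine and_congr_right fun hg => ⟨fun hdual z hz => ?_, fun hpg V hVD hV c d s hcd hs => ?_⟩
  · obtain ⟨V, hVD, hV, hzV, s, hs⟩ := exists_isSqrtBranch hD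
      (h.differentiableOn_abreschRosenberg hD).continuousOn hz (hB z hz)
    have hm := h.mono hVD
    have hgs := (hm.isGeneratingSpinors_dual hs hV fun z hz => hphi z (hVD hz)).congr_normal
      fun z hz => (hinv z (hVD hz)).1
    have hs' := hs.congr fun z hz => (hinv z (hVD hz)).2.2
    have hgg := hdual V hVD hV _ _ s hgs hs'
    have hdd := h.spinorVec_dual_dual hD hB hfs hphi hz hzV hs' (hneg hVD hgs z hzV)
    rcases hgg.2.2.2 z hzV with ⟨-, hp⟩ | ⟨ho, hp⟩
    · rw [hp, hdd]
    · refine absurd ho (not_lt.mpr ?_)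
      have hp' : phi g z = spinorVec (Complex.I * a z) (-Complex.I * b z) := by
        rw [hp, hdd, h.phi_eq z hz, neg_spinorVec]
      rw [orient_eq hp', (hinv z hz).1, unitNormal_eq (h.phi_eq z hz), spinorNormal_I_mul,
        dotProduct_smul, spinorNormal_dotProduct_self, smul_eq_mul]
      have := spinorLen_nonneg (a z) (b z)
      have := spinorLen_nonneg (Complex.I * a z) (-Complex.I * b z)
      positivity
  · have hm := h.mono hVD
    have hs' : IsSqrtBranch V (abreschRosenberg f) s :=
      hs.congr fun z hz => (hinv z (hVD hz)).2.2.symm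
    have hsm := hm.contDiffOn_branch hV hs'
    have hsupp : ContDiffOn ℝ ∞ (fun z => (support fs (-unitNormal fs) z : ℂ)⁻¹) V := by
      have h1 := (contDiffOn_const (c := (4 : ℂ) ^ 2)).mul (hsm.mul (contDiffOn_conj hsm))
      have h2 : ContDiffOn ℝ ∞ (fun z => (4 ^ 2 * (s z * conj (s z)))⁻¹ *
          (support f (unitNormal f) z : ℂ)) V := by
        refine (h1.inv fun z hz => ?_).mul hm.contDiffOn_support
        have := branch_ne hs' hz
        simp [this]
      refine h2.congr fun z hz => ?_
      rw [(hinv z (hVD hz)).2.1]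
      push_cast
      rw [norm_eq_of_sq_eq_neg (hs'.2 z hz).2, inv_div, div_eq_mul_inv, mul_comm]
    have hdd := fun z hz => h.spinorVec_dual_dual hD hB hfs hphi (hVD hz) hz hs
      (hneg hVD hcd z hz)
    refine ⟨((contDiffOn_const (c := (4 : ℂ))).mul hsm).mul hsupp |>.mul hcd.2.1,
      ((contDiffOn_const (c := (4 : ℂ))).mul (contDiffOn_conj hsm).neg).mul hsupp |>.mul hcd.1,
      isUnitNormal_iff.mpr fun z hz => ?_, fun z hz => Or.inl ⟨?_, ?_⟩⟩
    · rw [(hinv z (hVD hz)).1, hpg z (hVD hz)]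
      exact isUnitNormal_iff.mp hm.isGeneratingSpinors.2.2.1 z hz
    · have hp := (hpg z (hVD hz)).trans (h.phi_eq z (hVD hz))
      rw [orient_eq hp, (hinv z (hVD hz)).1, ← orient_eq (h.phi_eq z (hVD hz))]
      exact orient_unitNormal_pos (h.phi_eq z (hVD hz)) (h.spinorLen_ne (hVD hz))
    · rw [hdd z hz, hpg z (hVD hz)]

end Dual

end IsMinimalSpinors

/-! ### Global properties -/

/-- The hypotheses on a surface, in terms of its spinors. -/
theorem IsMinimalSpinors.of_isMinimal {D : Set ℂ} (hD : IsOpen D) {f : ℂ → R3} {a b : ℂ → ℂ}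
    (hf : IsConformalImmersion D f) (hvert : IsNowhereVertical D f) (hmin : IsMinimal D f)
    (hab : IsGeneratingSpinors D f (unitNormal f) a b) : IsMinimalSpinors D f a b := by
  refine ⟨hf.1, hab.1, hab.2.1, fun z hz => hab.phi_eq hz, fun z hz => ?_, fun z hz h0 => ?_⟩
  · refine tension_eq_zero hD hf.1 hz (hab.phi_eq hz) (fun h0 => (hf.2 z hz).2 ?_)
      (fun w hw => (hf.2 w hw).1) (hmin z hz)
    rw [confFactor_eq (hab.phi_eq hz), h0]
    simp
  · refine hvert z hz ?_
    rw [unitNormal_eq (hab.phi_eq hz)]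
    simp [spinorNormal, h0]

theorem eventually_ne_zero_of_differentiableOn {D : Set ℂ} (hD : IsOpen D) (hDc : IsPreconnected D)
    {B : ℂ → ℂ} (hBd : DifferentiableOn ℂ B D) (hB : ∃ z ∈ D, B z ≠ 0) {z : ℂ} (hz : z ∈ D) :
    ∀ᶠ w in 𝓝[≠] z, B w ≠ 0 := by
  obtain ⟨z₀, hz₀, hne⟩ := hB
  have hA := hBd.analyticOnNhd hD
  rcases (hA z hz).eventually_eq_zero_or_eventually_ne_zero with h0 | h0
  · exact absurd (hA.eqOn_zero_of_preconnected_of_eventuallyEq_zero hDc hz h0 hz₀) hne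
  · exact h0

theorem eq_of_eventually_nhdsNE {D : Set ℂ} (hD : IsOpen D) {F G : ℂ → ℂ}
    (hF : ContinuousOn F D) (hG : ContinuousOn G D) {z : ℂ} (hz : z ∈ D)
    (h : ∀ᶠ w in 𝓝[≠] z, F w = G w) : F z = G z :=
  tendsto_nhds_unique_of_eventuallyEq
    ((hF.continuousAt (hD.mem_nhds hz)).tendsto.mono_left nhdsWithin_le_nhds)
    ((hG.continuousAt (hD.mem_nhds hz)).tendsto.mono_left nhdsWithin_le_nhds) h

/-- Surfaces with the same Maurer–Cartan form off a discrete subset of a domain differ by one left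
translation. -/
theorem exists_eq_nilMul {D : Set ℂ} (hD : IsOpen D) (hDc : IsPreconnected D) {P : ℂ → Prop}
    (hP : ∀ z ∈ D, ∀ᶠ w in 𝓝[≠] z, P w) (hP' : ∃ z ∈ D, P z) {F G : ℂ → R3}
    (hopen : IsOpen {z ∈ D | P z})
    (hF : ContDiffOn ℝ ∞ F {z ∈ D | P z}) (hG : ContDiffOn ℝ ∞ G {z ∈ D | P z})
    (h : ∀ z ∈ D, P z → phi F z = phi G z) :
    ∃ p : R3, ∀ z ∈ D, P z → F z = nilMul p (G z) := by
  have hd : ∀ z ∈ {z ∈ D | P z}, HasFDerivAt (fun w => nilMul (F w) (-G w)) (0 : ℂ →L[ℝ] R3) z :=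
    fun z hz => hasFDerivAt_nilMul_neg (hF.differentiableAt_of_isOpen hopen hz)
      (hG.differentiableAt_of_isOpen hopen hz) (h z hz.1 hz.2)
  have hloc : ∀ {S : Set ℂ}, IsOpen S → IsPreconnected S → S ⊆ {z ∈ D | P z} →
      ∃ c, ∀ w ∈ S, nilMul (F w) (-G w) = c := fun hS hSc hSD =>
    hS.exists_is_const_of_fderiv_eq_zero hSc
      (fun w hw => (hd w (hSD hw)).differentiableAt.differentiableWithinAt)
      fun w hw => (hd w (hSD hw)).fderiv
  have hconst : ∀ z ∈ D, ∃ c, ∀ᶠ w in 𝓝[≠] z, nilMul (F w) (-G w) = c := by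
    intro z hz
    have hevD : ∀ᶠ w in 𝓝 z, w ∈ D := hD.mem_nhds hz
    have hev : ∀ᶠ w in 𝓝 z, w ∈ D ∧ (w ≠ z → P w) :=
      hevD.and (eventually_nhdsWithin_iff.mp (hP z hz))
    obtain ⟨r, hr, hball⟩ := Metric.eventually_nhds_iff_ball.mp hev
    obtain ⟨c, hc⟩ := hloc (Metric.isOpen_ball.sdiff isClosed_singleton)
      (isPreconnected_ball_diff_singleton z hr)
      fun w hw => ⟨(hball w hw.1).1, (hball w hw.1).2 hw.2⟩
    refine ⟨c, ?_⟩
    filter_upwards [mem_nhdsWithin_of_mem_nhds (Metric.ball_mem_nhds z hr),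
      self_mem_nhdsWithin] with w hw hwz using hc w ⟨hw, hwz⟩
  obtain ⟨z₀, hz₀, -⟩ := hP'
  obtain ⟨p, hp⟩ := hconst z₀ hz₀
  refine ⟨p, fun z hz hPz => nilMul_neg_eq_iff.mp ?_⟩
  have h1 := hDc.exists_forall_eventually_eq hconst hz₀ hp z hz
  obtain ⟨r, hr, hball⟩ := Metric.isOpen_iff.mp hopen z ⟨hz, hPz⟩
  obtain ⟨c, hc⟩ := hloc Metric.isOpen_ball (convex_ball z r).isPreconnected hball
  obtain ⟨w, hw1, hw2⟩ :=
    (h1.and (mem_nhdsWithin_of_mem_nhds (Metric.ball_mem_nhds z hr))).exists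
  rw [hc z (Metric.mem_ball_self hr), ← hc w hw2, hw1]

end

theorem theorem2p1 (D : Set ℂ) (hD : IsOpen D) (hDsc : SimplyConnectedSpace D)
    (f : ℂ → R3) (ψ₁ ψ₂ : ℂ → ℂ)
    (hf : IsConformalImmersion D f) (hvert : IsNowhereVertical D f) (hmin : IsMinimal D f)
    (hψ : IsGeneratingSpinors D f (unitNormal f) ψ₁ ψ₂)
    (hB : ∃ z ∈ D, abreschRosenberg f z ≠ 0) :
    -- the zeros of `B` are isolated
    (∀ z ∈ D, abreschRosenberg f z = 0 → ∀ᶠ z' in 𝓝[≠] z, abreschRosenberg f z' ≠ 0) ∧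
    -- the linear spinor system of the dual spinors
    (∀ V ⊆ D, IsOpen V → ∀ s : ℂ → ℂ, IsSqrtBranch V (abreschRosenberg f) s →
      ContDiffOn ℝ ∞ (dualSpinor₁ f (unitNormal f) s ψ₂) V ∧
      ContDiffOn ℝ ∞ (dualSpinor₂ f (unitNormal f) s ψ₁) V ∧
      ∃ w : ℂ → ℂ, ContDiffOn ℝ ∞ w V ∧
        (∀ z ∈ V, Complex.exp (w z / 2) =
          4 * Complex.I * (‖abreschRosenberg f z‖ : ℂ) / (support f (unitNormal f) z : ℂ)) ∧
        LinearSpinorSystem V (dualSpinor₁ f (unitNormal f) s ψ₂)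
          (dualSpinor₂ f (unitNormal f) s ψ₁) w (abreschRosenberg f)) ∧
    -- the dual surface exists
    (∃ fs : ℂ → R3, IsDualSurface D f (unitNormal f) fs) ∧
    -- its properties; the chosen normal of `fs` is `-unitNormal fs`
    ∀ fs : ℂ → R3, IsDualSurface D f (unitNormal f) fs →
      IsConformalImmersion {z ∈ D | abreschRosenberg f z ≠ 0} fs ∧
      (∀ z ∈ D, abreschRosenberg f z ≠ 0 →
        (-unitNormal fs) z = unitNormal f z ∧
        diracPotential fs (-unitNormal fs) z =
          4 * Complex.I * (‖abreschRosenberg f z‖ : ℂ) / (support f (unitNormal f) z : ℂ) ∧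
        support fs (-unitNormal fs) z =
          4 ^ 2 * ‖abreschRosenberg f z‖ / support f (unitNormal f) z ∧
        abreschRosenberg fs z = abreschRosenberg f z ∧
        gaussMap (-unitNormal fs) z = gaussMap (unitNormal f) z) ∧
      (∀ z ∈ D, confFactor fs z =
        4 ^ 4 * ‖abreschRosenberg f z‖ ^ 2 / support f (unitNormal f) z ^ 4 * confFactor f z) ∧
      IsNowhereVertical {z ∈ D | abreschRosenberg f z ≠ 0} fs ∧
      IsMinimal {z ∈ D | abreschRosenberg f z ≠ 0} fs ∧
      -- the duality: `f` is a dual surface of `fs`, and the only one up to left translation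
      IsDualSurface {z ∈ D | abreschRosenberg f z ≠ 0} fs (-unitNormal fs) f ∧
      ∀ fss : ℂ → R3,
        IsDualSurface {z ∈ D | abreschRosenberg f z ≠ 0} fs (-unitNormal fs) fss →
          ∃ p : R3, ∀ z ∈ D, abreschRosenberg f z ≠ 0 → fss z = nilMul p (f z) := by
  have h := IsMinimalSpinors.of_isMinimal hD hf hvert hmin hψ
  have hDc : IsPreconnected D := isPreconnected_iff_preconnectedSpace.mpr inferInstance
  have hBd := h.differentiableOn_abreschRosenberg hD
  have hiso : ∀ z ∈ D, ∀ᶠ w in 𝓝[≠] z, abreschRosenberg f w ≠ 0 :=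
    fun z hz => eventually_ne_zero_of_differentiableOn hD hDc hBd hB hz
  have hsub : {z ∈ D | abreschRosenberg f z ≠ 0} ⊆ D := fun z hz => hz.1
  have hopen : IsOpen {z ∈ D | abreschRosenberg f z ≠ 0} :=
    hBd.continuousOn.isOpen_inter_preimage hD isOpen_compl_singleton
  refine ⟨fun z hz _ => hiso z hz, fun V hVD hV s hs => ?_, ?_, fun fs hfs => ?_⟩
  · have hm := h.mono hVD
    exact ⟨hm.contDiffOn_dualSpinor₁ hV hs, hm.contDiffOn_dualSpinor₂ hV hs,
      hm.exists_linearSpinorSystem hV hs⟩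
  · obtain ⟨fs, hfs, hphi⟩ := exists_phi_eq hD (h.contDiffOn_dualPhi hD)
      fun z hz k => h.dzbar_dualPhi hD hz k
    exact ⟨fs, (h.isDualSurface_iff hD).mpr ⟨hfs, fun z hz _ => hphi z hz⟩⟩
  obtain ⟨hsm, hphi⟩ := (h.isDualSurface_iff hD).mp hfs
  have hm := h.mono hsub
  have hphi' : ∀ z ∈ {z ∈ D | abreschRosenberg f z ≠ 0}, phi fs z = dualPhi f (unitNormal f) z :=
    fun z hz => hphi z hz.1 hz.2
  have hinv := fun z (hz : z ∈ {z ∈ D | abreschRosenberg f z ≠ 0}) =>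
    hm.dual_invariants hopen (fun z hz => hz.2) (hsm.mono hsub) hphi' hz
  have hconf : ∀ z ∈ D, confFactor fs z =
      4 ^ 4 * ‖abreschRosenberg f z‖ ^ 2 / support f (unitNormal f) z ^ 4 * confFactor f z := by
    intro z hz
    refine confFactor_of_phi_eq_dualPhi (funext fun k => ?_)
    refine eq_of_eventually_nhdsNE hD (contDiffOn_phi hD hsm k).continuousOn
      (h.contDiffOn_dualPhi hD k).continuousOn hz ?_
    filter_upwards [hiso z hz, mem_nhdsWithin_of_mem_nhds (hD.mem_nhds hz)] with w hw hwD
    rw [hphi w hwD hw]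
  have hmean : ∀ z ∈ {z ∈ D | abreschRosenberg f z ≠ 0}, ∀ N, meanCurv fs N z = 0 :=
    fun z hz N => meanCurv_eq_zero hopen (hsm.mono hsub) hz
      (hm.tension_eq_zero_of_phi_eq hopen hphi' hz) N
  have hdd := fun g => hm.isDualSurface_dual_iff (g := g) hopen (fun z hz => hz.2)
    (hsm.mono hsub) hphi'
  refine ⟨⟨hsm.mono hsub, fun z hz => ⟨?_, ?_⟩⟩, fun z hz hBz => ?_, hconf, fun z hz h0 => ?_,
    fun z hz => hmean z hz _, (hdd f).mpr ⟨hf.1.mono hsub, fun z _ => rfl⟩, fun fss hfss => ?_⟩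
  · have h1 := congrArg conj (hf.2 z hz.1).1
    simp only [map_sum, map_pow, map_zero] at h1
    simp only [hphi' z hz, dualPhi, mul_pow, ← Finset.mul_sum, h1, mul_zero]
  · rw [hconf z hz.1]
    have h1 := norm_pos_iff.mpr hz.2
    have h2 := h.support_ne hz.1
    have h3 := (hf.2 z hz.1).2
    positivity
  · obtain ⟨h1, h2, h3⟩ := hinv z ⟨hz, hBz⟩
    refine ⟨h1, ?_, h2, h3, ?_⟩
    · rw [diracPotential, hmean z ⟨hz, hBz⟩, h2]
      push_cast
      ring
    · rw [gaussMap, gaussMap, h1]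
  · have h1 := congrFun (hinv z hz).1 2
    rw [Pi.neg_apply, Pi.neg_apply, h0, neg_zero] at h1
    exact hvert z hz.1 h1.symm
  · obtain ⟨hg, hpg⟩ := (hdd fss).mp hfss
    exact exists_eq_nilMul hD hDc hiso hB hopen hg (hf.1.mono hsub)
      fun z hz hBz => hpg z ⟨hz, hBz⟩
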